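/- **Setting.** Let $(\Omega,\mathscr F,P)$ be a probability space with a filtration $\mathbb F=(\mathscr F_t)_{t\ge 0}$ satisfying the usual conditions, and let $\mathscr T$ be the set of stopping times with values in $[0,\infty]$. For the firms $i\in\{1,2\}$ let $\pi^{0i},\pi^{Li},\pi^{Fi},\pi^{Bi}$ be product-measurable, $P\otimes dt$-integrable revenue processes on $\Omega\times[0,\infty)$ whose integrals $\int_0^t\pi_s\,ds$ are adapted, and such that $P\otimes dt$-a.e. $\pi^{Li}\ge\pi^{Bi}$ and $\pi^{0i}\ge\pi^{Fi}$ for $i=1,2$, $\pi^{B2}-\pi^{F2}\le\pi^{B1}-\pi^{F1}$ and $\pi^{L2}-\pi^{F2}\le\pi^{L1}-\pi^{F1}$. (In)equalities between random variables are understood $P$-a.s. Let $j$ denote the opponent of firm $i$. For $\tau\in\mathscr T$ let $\tau^i_F(\tau)$ be the latest stopping time $\tau'\ge\tau$ attaining the essential supremum in $$F^i_\tau=\int_0^\tau\pi^{0i}_s\,ds+\operatorname*{ess\,sup}_{\tau'\ge\tau}E\Bigl[\int_\tau^{\tau'}\pi^{Fi}_s\,ds+\int_{\tau'}^\infty\pi^{Bi}_s\,ds\Bigm|\mathscr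 F_\tau\Bigr],$$ and put $$L^i_\tau=\int_0^\tau\pi^{0i}_s\,ds+E\Bigl[\int_\tau^{\tau^j_F(\tau)}\pi^{Li}_s\,ds+\int_{\tau^j_F(\tau)}^\infty\pi^{Bi}_s\,ds\Bigm|\mathscr F_\tau\Bigr],\qquad M^i_\tau=\int_0^\tau\pi^{0i}_s\,ds+E\Bigl[\int_\tau^\infty\pi^{Bi}_s\,ds\Bigm|\mathscr F_\tau\Bigr].$$ Let $(F^i_t),(L^i_t),(M^i_t)$, $t\in[0,\infty]$, be the processes, right-continuous at all $t<\infty$, that have these values at every $\tau\in\mathscr T$; they are unique up to indistinguishability. For $t\in[0,\infty]$ let $\tau_{\mathcal P}(t)=\inf\{s\in[t,\infty): L^1_s>F^1_s\text{ and }L^2_s>F^2_s\}$, with $\inf\emptyset=\infty$. If firm $i$ plans to invest at $\tau\in\mathscr T$ and firm $j$ at $\tau^j\in\mathscr T$, firm $i$ obtains $L^i_\tau$ where $\tau<\tau^j$, $F^i_{\tau^j}$ where $\tau>\tau^j$, and $S^i_\tau$ where $\tau=\tau^j$. Here either $S^i=M^i$ throughout (no preemption), or (preemption) $S^i_t$ is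 modified at those $t<\infty$ with $t=\tau_{\mathcal P}(t)$ to $F^i_t$ if $L^j_t\ne F^j_t$ and to $L^i_t$ if $L^j_t=F^j_t$. In the subgame beginning at $\vartheta\in\mathscr T$ the plans of firm $i$ are the $\tau\in\mathscr T$ with $\tau\ge\vartheta$. A mixed plan of firm $j$ is a jointly measurable family $(r_u)_{u\in[0,1]}$ of such plans, where $u$ is drawn uniformly and independently; a pure plan is a constant family. The payoff of $\tau$ against $(r_u)$ is the conditional expectation given $\mathscr F_\vartheta$ of the realized payoff averaged over $u$. **Lemma.** Under either specification of $S$ the following hold. (i) Let $i\in\{1,2\}$, $\vartheta\in\mathscr T$, let $(r_u)$ be a pure or mixed plan of firm $j$ and $\tau$ a plan of firm $i$ in the subgame at $\vartheta$, and let $B\in\mathscr F_\vartheta$ be an event on which $\tau$ is optimal for firm $i$, i.e. a.s. on $B$ its payoff is at least that of every other plan of firm $i$. Then, for a.e. $\omega\in B$ with $F^i_\tau>L^i_\tau$, firm $j$ invests before $\tau$ with probability one: $r_u(\omega)<\tau(\omega)$ for a.e. $u$. That is, an optimal plan never makes a firm invest, as leader or simultaneously, where $F^i>L^i$. (ii)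 For every $\vartheta\in\mathscr T$ and every pure or mixed plan of firm $1$ in the subgame at $\vartheta$, the essential supremum of firm $2$'s payoffs over all plans $\tau\ge\vartheta$ exists and equals the essential supremum of its payoffs over the plans $\tau\ge\min\{\tau_{\mathcal P}(\vartheta),\tau^2_F(\vartheta)\}$ only. -/

import Mathlib

open MeasureTheory Filter Topology
open scoped NNReal

namespace TimingGame

/-- The two firms. -/
inductive Firm where
  | one
  | two

/-- The opponent of a firm. -/
def Firm.other : Firm → Firm
  | .one => .two
  | .two => .one

/-- Stopping times with values in `[0, ∞]`. They are also the plans of action of the firms. -/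
abbrev StopTime {Ω : Type*} {m : MeasurableSpace Ω} (𝓕 : Filtration ℝ≥0 m) : Type _ :=
  {τ : Ω → WithTop ℝ≥0 // IsStoppingTime 𝓕 τ}

/-- The σ-algebra of events known at the stopping time `τ`. -/
abbrev StopTime.info {Ω : Type*} {m : MeasurableSpace Ω} {𝓕 : Filtration ℝ≥0 m}
    (τ : StopTime 𝓕) : MeasurableSpace Ω :=
  τ.2.measurableSpace

/-- The usual conditions: right-continuity, and every `P`-null set belongs to `𝓕 0`. -/
structure UsualConditions {Ω : Type*} {m : MeasurableSpace Ω} (P : Measure Ω)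
    (𝓕 : Filtration ℝ≥0 m) : Prop where
  rightCont : 𝓕.IsRightContinuous
  complete : ∀ s : Set Ω, P s = 0 → MeasurableSet[𝓕 0] s

/-- Lebesgue measure on the time axis `[0, ∞)`. -/
noncomputable def dt : Measure ℝ≥0 :=
  (volume : Measure ℝ).comap NNReal.toReal

/-- The revenue `∫_a^b π_s ds` accrued from `a` to `b`, where `0 ≤ a ≤ b ≤ ∞`. -/
noncomputable def accrued {Ω : Type*} (π : ℝ≥0 → Ω → ℝ) (a b : WithTop ℝ≥0) (ω : Ω) : ℝ :=
  ∫ s in {s : ℝ≥0 | a ≤ (s : WithTop ℝ≥0) ∧ (s : WithTop ℝ≥0) < b}, π s ω ∂dt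

/-- An admissible revenue stream: product-measurable, `dt ⊗ P`-integrable, and such that the
accrued revenue is adapted. -/
structure IsRevenue {Ω : Type*} {m : MeasurableSpace Ω} (P : Measure Ω)
    (𝓕 : Filtration ℝ≥0 m) (π : ℝ≥0 → Ω → ℝ) : Prop where
  measurable : Measurable fun p : ℝ≥0 × Ω => π p.1 p.2
  integrable : Integrable (fun p : ℝ≥0 × Ω => π p.1 p.2) (dt.prod P)
  adapted : ∀ t : ℝ≥0, Measurable[𝓕 t] fun ω => accrued π 0 (t : WithTop ℝ≥0) ω

/-- The revenue streams of both firms: `rev0 i` before any investment, `revL i` when only firm `i`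
has invested, `revF i` when only the opponent of `i` has invested, and `revB i` when both have.
Inequalities between streams hold `dt ⊗ P`-almost everywhere. -/
structure Revenues {Ω : Type*} {m : MeasurableSpace Ω} (P : Measure Ω)
    (𝓕 : Filtration ℝ≥0 m) where
  rev0 : Firm → ℝ≥0 → Ω → ℝ
  revL : Firm → ℝ≥0 → Ω → ℝ
  revF : Firm → ℝ≥0 → Ω → ℝ
  revB : Firm → ℝ≥0 → Ω → ℝ
  isRevenue_rev0 : ∀ i, IsRevenue P 𝓕 (rev0 i)
  isRevenue_revL : ∀ i, IsRevenue P 𝓕 (revL i)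
  isRevenue_revF : ∀ i, IsRevenue P 𝓕 (revF i)
  isRevenue_revB : ∀ i, IsRevenue P 𝓕 (revB i)
  /-- The follower's investment does not benefit the leader. -/
  revB_le_revL : ∀ i, ∀ᵐ p : ℝ≥0 × Ω ∂(dt.prod P),
    revB i p.1 p.2 ≤ revL i p.1 p.2
  /-- The leader's investment does not benefit the laggard. -/
  revF_le_rev0 : ∀ i, ∀ᵐ p : ℝ≥0 × Ω ∂(dt.prod P),
    revF i p.1 p.2 ≤ rev0 i p.1 p.2
  /-- Firm 2 gains less as second investor. -/
  disadvantage_B : ∀ᵐ p : ℝ≥0 × Ω ∂(dt.prod P),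
    revB .two p.1 p.2 - revF .two p.1 p.2 ≤ revB .one p.1 p.2 - revF .one p.1 p.2
  /-- Firm 2 gains less as first investor. -/
  disadvantage_L : ∀ᵐ p : ℝ≥0 × Ω ∂(dt.prod P),
    revL .two p.1 p.2 - revF .two p.1 p.2 ≤ revL .one p.1 p.2 - revF .one p.1 p.2

/-- `X` is the `P`-essential supremum of the family `S` of real random variables. -/
structure IsEssSup {Ω : Type*} {m : MeasurableSpace Ω} (P : Measure Ω) (S : Set (Ω → ℝ))
    (X : Ω → ℝ) : Prop where
  aemeasurable : AEMeasurable X P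
  le : ∀ Y ∈ S, Y ≤ᵐ[P] X
  least : ∀ Z : Ω → ℝ, AEMeasurable Z P → (∀ Y ∈ S, Y ≤ᵐ[P] Z) → X ≤ᵐ[P] Z

section Payoffs

variable {Ω : Type*} {m : MeasurableSpace Ω} {P : Measure Ω} {𝓕 : Filtration ℝ≥0 m}

/-- What firm `i` expects at `τ` to earn from `τ` on if the opponent has invested at `τ` and
firm `i` follows at `τ'`. -/
noncomputable def followerGain (R : Revenues P 𝓕) (i : Firm) (τ τ' : StopTime 𝓕) : Ω → ℝ :=
  P[fun ω => accrued (R.revF i) (τ.1 ω) (τ'.1 ω) ω + accrued (R.revB i) (τ'.1 ω) ⊤ ω | τ.info]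

/-- `σ` is an optimal time for firm `i` to follow an investment of the opponent at `τ`. -/
def IsOptimalFollowerTime (R : Revenues P 𝓕) (i : Firm) (τ σ : StopTime 𝓕) : Prop :=
  τ.1 ≤ᵐ[P] σ.1 ∧
    ∀ τ' : StopTime 𝓕, τ.1 ≤ᵐ[P] τ'.1 → followerGain R i τ τ' ≤ᵐ[P] followerGain R i τ σ

/-- `σ` is the latest optimal time for firm `i` to follow an investment of the opponent at `τ`. -/
def IsFollowerTime (R : Revenues P 𝓕) (i : Firm) (τ σ : StopTime 𝓕) : Prop :=
  IsOptimalFollowerTime R i τ σ ∧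
    ∀ σ' : StopTime 𝓕, IsOptimalFollowerTime R i τ σ' → σ'.1 ≤ᵐ[P] σ.1

/-- All paths are right-continuous at all finite times. (The value at time `∞` is separate.) -/
def RightContPaths (X : WithTop ℝ≥0 → Ω → ℝ) : Prop :=
  ∀ (ω : Ω) (t : ℝ≥0),
    ContinuousWithinAt (fun s : ℝ≥0 => X (s : WithTop ℝ≥0) ω) (Set.Ici t) t

/-- `F` is the right-continuous process of firm `i`'s follower payoffs: at every stopping time it
has the value of the optimal follower problem. -/
def IsFollowerPayoff (R : Revenues P 𝓕) (i : Firm) (F : WithTop ℝ≥0 → Ω → ℝ) : Prop :=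
  RightContPaths F ∧ ∀ τ : StopTime 𝓕,
    IsEssSup P {Y | ∃ τ' : StopTime 𝓕, τ.1 ≤ᵐ[P] τ'.1 ∧ Y = followerGain R i τ τ'}
      (fun ω => F (τ.1 ω) ω - accrued (R.rev0 i) 0 (τ.1 ω) ω)

/-- `L` is the right-continuous process of firm `i`'s leader payoffs, when the opponent follows an
investment at `τ` at the time `τF i.other τ`. -/
def IsLeaderPayoff (R : Revenues P 𝓕) (τF : Firm → StopTime 𝓕 → StopTime 𝓕) (i : Firm)
    (L : WithTop ℝ≥0 → Ω → ℝ) : Prop :=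
  RightContPaths L ∧ ∀ τ : StopTime 𝓕,
    (fun ω => L (τ.1 ω) ω) =ᵐ[P] fun ω => accrued (R.rev0 i) 0 (τ.1 ω) ω +
      (P[fun ω' => accrued (R.revL i) (τ.1 ω') ((τF i.other τ).1 ω') ω'
          + accrued (R.revB i) ((τF i.other τ).1 ω') ⊤ ω' | τ.info]) ω

/-- `M` is the right-continuous process of firm `i`'s payoffs from simultaneous investment. -/
def IsSimultaneousPayoff (R : Revenues P 𝓕) (i : Firm) (M : WithTop ℝ≥0 → Ω → ℝ) : Prop :=
  RightContPaths M ∧ ∀ τ : StopTime 𝓕,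
    (fun ω => M (τ.1 ω) ω) =ᵐ[P] fun ω => accrued (R.rev0 i) 0 (τ.1 ω) ω +
      (P[fun ω' => accrued (R.revB i) (τ.1 ω') ⊤ ω' | τ.info]) ω

/-- The first time from `t` on at which both firms have a strict first-mover advantage. -/
noncomputable def preemptionTime (L F : Firm → WithTop ℝ≥0 → Ω → ℝ) (t : WithTop ℝ≥0) (ω : Ω) :
    WithTop ℝ≥0 :=
  sInf {s | t ≤ s ∧ s ≠ ⊤ ∧ F .one s ω < L .one s ω ∧ F .two s ω < L .two s ω}

open Classical in
/-- Payoffs if both firms plan to invest at `t`, with preemption: where `t` is a first hitting time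
of the preemption region, each firm obtains its follower payoff, except that the opponent of a
firm that is indifferent between leading and following becomes leader. -/
noncomputable def preemptionPayoff (L F M : Firm → WithTop ℝ≥0 → Ω → ℝ) (i : Firm)
    (t : WithTop ℝ≥0) (ω : Ω) : ℝ :=
  if t ≠ ⊤ ∧ preemptionTime L F t ω = t then
    if L i.other t ω = F i.other t ω then L i t ω else F i t ω
  else M i t ω

/-- A mixed plan for the subgame beginning at `ϑ`: a randomized stopping time, i.e. a jointly
measurable family of stopping times from `ϑ` on, indexed by an independent uniform random
variable. A pure plan is a constant family. -/
structure MixedPlan (P : Measure Ω) (ϑ : StopTime 𝓕) where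
  plan : unitInterval → StopTime 𝓕
  measurable : Measurable fun p : unitInterval × Ω => (plan p.1).1 p.2
  ge : ∀ u, ϑ.1 ≤ᵐ[P] (plan u).1

/-- The payoff realized from own planned date `a` and opponent's planned date `b`, from the leader,
follower and simultaneous payoff processes. -/
noncomputable def outcome (L F S : WithTop ℝ≥0 → Ω → ℝ) (a b : WithTop ℝ≥0) (ω : Ω) : ℝ :=
  if a < b then L a ω else if b < a then F b ω else S a ω

/-- The conditional expected payoff at `ϑ` of the plan `τ` against the mixed plan `r`. -/
noncomputable def expectedPayoff (L F S : WithTop ℝ≥0 → Ω → ℝ) {ϑ : StopTime 𝓕}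
    (r : MixedPlan P ϑ) (τ : StopTime 𝓕) : Ω → ℝ :=
  P[fun ω => ∫ u : unitInterval, outcome L F S (τ.1 ω) ((r.plan u).1 ω) ω | ϑ.info]

/-- On the event `B`, the plan `τ` is an optimal plan in the subgame beginning at `ϑ` against the
mixed plan `r`. -/
def IsOptimalOn (L F S : WithTop ℝ≥0 → Ω → ℝ) {ϑ : StopTime 𝓕} (r : MixedPlan P ϑ)
    (τ : StopTime 𝓕) (B : Set Ω) : Prop :=
  ϑ.1 ≤ᵐ[P] τ.1 ∧ ∀ τ' : StopTime 𝓕, ϑ.1 ≤ᵐ[P] τ'.1 →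
    ∀ᵐ ω ∂P, ω ∈ B → expectedPayoff L F S r τ' ω ≤ expectedPayoff L F S r τ ω

end Payoffs

end TimingGame

set_option linter.unusedSectionVars false

namespace TimingGame

instance sFinite_dt : SFinite dt := by
  have h : IsClosedEmbedding NNReal.toReal := NNReal.isClosedEmbedding_coe
  have : IsFiniteMeasureOnCompacts dt :=
    IsFiniteMeasureOnCompacts.comap' _ h.continuous h.measurableEmbedding
  infer_instance

section Accrued

variable {Ω : Type*} {m : MeasurableSpace Ω} {P : Measure Ω} {𝓕 : Filtration ℝ≥0 m}
variable {π π' : ℝ≥0 → Ω → ℝ} {a b c : WithTop ℝ≥0} {ω : Ω}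

/-- The time interval from `a` to `b`, as a set of finite times. -/
def timeIco (a b : WithTop ℝ≥0) : Set ℝ≥0 :=
  {s : ℝ≥0 | a ≤ (s : WithTop ℝ≥0) ∧ (s : WithTop ℝ≥0) < b}

lemma measurableSet_timeIco (a b : WithTop ℝ≥0) : MeasurableSet (timeIco a b) :=
  (measurableSet_Ici.preimage WithTop.measurable_coe).inter
    (measurableSet_Iio.preimage WithTop.measurable_coe)

lemma accrued_eq : accrued π a b ω = ∫ s in timeIco a b, π s ω ∂dt := rfl

lemma accrued_eq_zero (h : b ≤ a) : accrued π a b ω = 0 := by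
  have : timeIco a b = ∅ := by
    ext s
    simp only [timeIco, Set.mem_ofPred_eq, Set.mem_empty_iff_false, iff_false, not_and, not_lt]
    exact fun hs => h.trans hs
  rw [accrued_eq, this, setIntegral_empty]

lemma accrued_add (hπ : Integrable (fun s => π s ω) dt) (hab : a ≤ b) (hbc : b ≤ c) :
    accrued π a b ω + accrued π b c ω = accrued π a c ω := by
  have hu : timeIco a b ∪ timeIco b c = timeIco a c := by
    ext s
    simp only [timeIco, Set.mem_union, Set.mem_ofPred_eq]
    constructor
    · rintro (h | h)
      · exact ⟨h.1, h.2.trans_le hbc⟩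
      · exact ⟨hab.trans h.1, h.2⟩
    · intro h
      rcases lt_or_ge (s : WithTop ℝ≥0) b with hs | hs
      · exact Or.inl ⟨h.1, hs⟩
      · exact Or.inr ⟨hs, h.2⟩
  have hd : Disjoint (timeIco a b) (timeIco b c) := by
    rw [Set.disjoint_left]
    exact fun s h h' => absurd h.2 (not_lt.mpr h'.1)
  rw [accrued_eq, accrued_eq, accrued_eq, ← hu,
    setIntegral_union hd (measurableSet_timeIco b c) hπ.integrableOn hπ.integrableOn]

lemma accrued_mono (hπ : Integrable (fun s => π s ω) dt) (hπ' : Integrable (fun s => π' s ω) dt)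
    (h : ∀ᵐ s ∂dt, π s ω ≤ π' s ω) : accrued π a b ω ≤ accrued π' a b ω :=
  setIntegral_mono_ae hπ.integrableOn hπ'.integrableOn h

lemma accrued_sub (hπ : Integrable (fun s => π s ω) dt)
    (hπ' : Integrable (fun s => π' s ω) dt) :
    accrued (fun s ω => π s ω - π' s ω) a b ω = accrued π a b ω - accrued π' a b ω :=
  integral_sub hπ.integrableOn hπ'.integrableOn

/-- The total absolute revenue over the whole time axis. -/
noncomputable def total (π : ℝ≥0 → Ω → ℝ) (ω : Ω) : ℝ := ∫ s, |π s ω| ∂dt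

lemma total_nonneg : 0 ≤ total π ω := integral_nonneg fun _ => abs_nonneg _

lemma abs_accrued_le (hπ : Integrable (fun s => π s ω) dt) : |accrued π a b ω| ≤ total π ω := by
  refine (abs_integral_le_integral_abs).trans ?_
  exact setIntegral_le_integral hπ.abs (Eventually.of_forall fun _ => abs_nonneg _)

lemma abs_accrued_add_le (hπ : Integrable (fun s => π s ω) dt)
    (hπ' : Integrable (fun s => π' s ω) dt) :
    |accrued π a b ω + accrued π' b c ω| ≤ total π ω + total π' ω :=
  (abs_add_le _ _).trans (add_le_add (abs_accrued_le hπ) (abs_accrued_le hπ'))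

variable [IsProbabilityMeasure P]

lemma IsRevenue.ae_integrable (h : IsRevenue P 𝓕 π) :
    ∀ᵐ ω ∂P, Integrable (fun s => π s ω) dt :=
  h.integrable.prod_left_ae

lemma IsRevenue.integrable_total (h : IsRevenue P 𝓕 π) : Integrable (total π) P :=
  h.integrable.abs.integral_prod_right

lemma IsRevenue.integrable_accrued (h : IsRevenue P 𝓕 π) {a b : Ω → WithTop ℝ≥0}
    (ha : Measurable a) (hb : Measurable b) :
    Integrable (fun ω => accrued π (a ω) (b ω) ω) P := by
  have hs : MeasurableSet {p : ℝ≥0 × Ω | p.1 ∈ timeIco (a p.2) (b p.2)} :=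
    (measurableSet_le (ha.comp measurable_snd) (WithTop.measurable_coe.comp measurable_fst)).inter
      (measurableSet_lt (WithTop.measurable_coe.comp measurable_fst) (hb.comp measurable_snd))
  have hi := (h.integrable.indicator hs).integral_prod_right
  refine hi.congr (Eventually.of_forall fun ω => ?_)
  change _ = ∫ s in timeIco (a ω) (b ω), π s ω ∂dt
  rw [← integral_indicator (measurableSet_timeIco _ _)]
  rfl

lemma ae_ae_time {p : ℝ≥0 → Ω → Prop} (h : ∀ᵐ q : ℝ≥0 × Ω ∂(dt.prod P), p q.1 q.2) :
    ∀ᵐ ω ∂P, ∀ᵐ s ∂dt, p s ω := by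
  have := Measure.measurePreserving_swap (μ := P) (ν := dt)
  exact Measure.ae_ae_of_ae_prod (this.quasiMeasurePreserving.ae h)

end Accrued

section Regular

variable {Ω : Type*} {m : MeasurableSpace Ω} {P : Measure Ω} {𝓕 : Filtration ℝ≥0 m}

/-- A path along which all revenue streams are integrable and satisfy the standing inequalities
almost everywhere. -/
structure Revenues.Regular (R : Revenues P 𝓕) (ω : Ω) : Prop where
  int0 : ∀ i, Integrable (fun s => R.rev0 i s ω) dt
  intL : ∀ i, Integrable (fun s => R.revL i s ω) dt
  intF : ∀ i, Integrable (fun s => R.revF i s ω) dt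
  intB : ∀ i, Integrable (fun s => R.revB i s ω) dt
  B_le_L : ∀ i, ∀ᵐ s ∂dt, R.revB i s ω ≤ R.revL i s ω
  F_le_0 : ∀ i, ∀ᵐ s ∂dt, R.revF i s ω ≤ R.rev0 i s ω
  disB : ∀ᵐ s ∂dt, R.revB .two s ω - R.revF .two s ω ≤ R.revB .one s ω - R.revF .one s ω
  disL : ∀ᵐ s ∂dt, R.revL .two s ω - R.revF .two s ω ≤ R.revL .one s ω - R.revF .one s ω

lemma Firm.ae_all {p : Firm → Ω → Prop} (h : ∀ i, ∀ᵐ ω ∂P, p i ω) : ∀ᵐ ω ∂P, ∀ i, p i ω := by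
  filter_upwards [h .one, h .two] with ω h1 h2 i
  cases i
  exacts [h1, h2]

lemma Revenues.ae_regular [IsProbabilityMeasure P] (R : Revenues P 𝓕) : ∀ᵐ ω ∂P, R.Regular ω := by
  filter_upwards [Firm.ae_all fun i => (R.isRevenue_rev0 i).ae_integrable,
    Firm.ae_all fun i => (R.isRevenue_revL i).ae_integrable,
    Firm.ae_all fun i => (R.isRevenue_revF i).ae_integrable,
    Firm.ae_all fun i => (R.isRevenue_revB i).ae_integrable,
    Firm.ae_all fun i => ae_ae_time (p := fun s ω => R.revB i s ω ≤ R.revL i s ω) (R.revB_le_revL i),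
    Firm.ae_all fun i => ae_ae_time (p := fun s ω => R.revF i s ω ≤ R.rev0 i s ω) (R.revF_le_rev0 i),
    ae_ae_time (p := fun s ω => R.revB .two s ω - R.revF .two s ω ≤
      R.revB .one s ω - R.revF .one s ω) R.disadvantage_B,
    ae_ae_time (p := fun s ω => R.revL .two s ω - R.revF .two s ω ≤
      R.revL .one s ω - R.revF .one s ω) R.disadvantage_L] with ω h1 h2 h3 h4 h5 h6 h7 h8
  exact ⟨h1, h2, h3, h4, h5, h6, h7, h8⟩

end Regular

section StoppingTimes

variable {Ω : Type*} {m : MeasurableSpace Ω} {P : Measure Ω} {𝓕 : Filtration ℝ≥0 m}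

lemma StopTime.info_le (τ : StopTime 𝓕) : τ.info ≤ m := τ.2.measurableSpace_le

lemma StopTime.measurable (τ : StopTime 𝓕) : Measurable τ.1 := τ.2.measurable'

lemma StopTime.measurableSet_le_left (τ σ : StopTime 𝓕) :
    MeasurableSet[τ.info] {ω | τ.1 ω ≤ σ.1 ω} := τ.2.measurableSet_le_stopping_time σ.2

lemma StopTime.measurableSet_le_right (τ σ : StopTime 𝓕) :
    MeasurableSet[σ.info] {ω | τ.1 ω ≤ σ.1 ω} := τ.2.measurableSet_stopping_time_le σ.2

lemma StopTime.measurableSet_lt_left (τ σ : StopTime 𝓕) :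
    MeasurableSet[τ.info] {ω | τ.1 ω < σ.1 ω} := by
  have := (σ.measurableSet_le_right τ).compl
  rwa [show {ω | σ.1 ω ≤ τ.1 ω}ᶜ = {ω | τ.1 ω < σ.1 ω} by ext ω; simp] at this

lemma StopTime.measurableSet_of_le {τ σ : StopTime 𝓕} {A : Set Ω} (hA : MeasurableSet[τ.info] A)
    (h : ∀ ω ∈ A, τ.1 ω ≤ σ.1 ω) : MeasurableSet[σ.info] A := by
  have := τ.2.measurableSet_inter_le σ.2 A hA
  rw [IsStoppingTime.measurableSet_min_iff τ.2 σ.2] at this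
  rw [show A = A ∩ {ω | τ.1 ω ≤ σ.1 ω} by ext ω; simpa using h ω]
  exact this.2

open Classical in
/-- The stopping time that follows `σ` on `A` and `τ` elsewhere. -/
noncomputable def StopTime.paste (τ σ : StopTime 𝓕) (A : Set Ω) (hA : MeasurableSet[τ.info] A)
    (hA' : MeasurableSet[σ.info] A) : StopTime 𝓕 :=
  ⟨fun ω => if ω ∈ A then σ.1 ω else τ.1 ω, by
    intro i
    have hu : {ω | (if ω ∈ A then σ.1 ω else τ.1 ω) ≤ (i : WithTop ℝ≥0)} =
        (A ∩ {ω | σ.1 ω ≤ i}) ∪ (Aᶜ ∩ {ω | τ.1 ω ≤ i}) := by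
      ext ω
      by_cases hω : ω ∈ A <;> simp [hω]
    rw [hu]
    exact (hA'.2 i).union (hA.compl.2 i)⟩

lemma StopTime.paste_of_mem {τ σ : StopTime 𝓕} {A : Set Ω} (hA : MeasurableSet[τ.info] A)
    (hA' : MeasurableSet[σ.info] A) {ω : Ω} (hω : ω ∈ A) : (τ.paste σ A hA hA').1 ω = σ.1 ω :=
  if_pos hω

lemma StopTime.paste_of_notMem {τ σ : StopTime 𝓕} {A : Set Ω} (hA : MeasurableSet[τ.info] A)
    (hA' : MeasurableSet[σ.info] A) {ω : Ω} (hω : ω ∉ A) : (τ.paste σ A hA hA').1 ω = τ.1 ω :=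
  if_neg hω

lemma StopTime.le_paste {τ σ : StopTime 𝓕} {A : Set Ω} (hA : MeasurableSet[τ.info] A)
    (hA' : MeasurableSet[σ.info] A) (h : ∀ ω ∈ A, τ.1 ω ≤ σ.1 ω) (ω : Ω) : τ.1 ω ≤ (τ.paste σ A hA hA').1 ω := by
  by_cases hω : ω ∈ A
  · rw [paste_of_mem hA hA' hω]; exact h ω hω
  · rw [paste_of_notMem hA hA' hω]

/-- The later of two stopping times. -/
noncomputable def StopTime.later (τ σ : StopTime 𝓕) : StopTime 𝓕 :=
  ⟨fun ω => max (τ.1 ω) (σ.1 ω), τ.2.max σ.2⟩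

/-- A deterministic finite time. -/
def StopTime.const (𝓕 : Filtration ℝ≥0 m) (t : ℝ≥0) : StopTime 𝓕 :=
  ⟨fun _ => (t : WithTop ℝ≥0), isStoppingTime_const 𝓕 t⟩

lemma StopTime.info_const (t : ℝ≥0) : (StopTime.const 𝓕 t).info = 𝓕 t :=
  IsStoppingTime.measurableSpace_const 𝓕 t

lemma UsualConditions.measurableSet_of_null (h𝓕 : UsualConditions P 𝓕) {s : Set Ω} (hs : P s = 0)
    (t : ℝ≥0) : MeasurableSet[𝓕 t] s :=
  𝓕.mono zero_le _ (h𝓕.complete s hs)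

lemma UsualConditions.measurable_congr (h𝓕 : UsualConditions P 𝓕) {t : ℝ≥0} {f g : Ω → ℝ}
    (hg : Measurable[𝓕 t] g) (hfg : f =ᵐ[P] g) : Measurable[𝓕 t] f := by
  have hn : P {ω | f ω = g ω}ᶜ = 0 := hfg
  intro s hs
  have : f ⁻¹' s = (g ⁻¹' s ∩ {ω | f ω = g ω}) ∪ (f ⁻¹' s ∩ {ω | f ω = g ω}ᶜ) := by
    ext ω
    by_cases h : f ω = g ω <;> simp [h]
  rw [this]
  refine MeasurableSet.union ((hg hs).inter ?_)
    (h𝓕.measurableSet_of_null (measure_mono_null Set.inter_subset_right hn) t)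
  have := (h𝓕.measurableSet_of_null hn t).compl
  rwa [compl_compl] at this

lemma UsualConditions.measurable_of_aemeasurable (h𝓕 : UsualConditions P 𝓕) {f : Ω → ℝ}
    (hf : AEMeasurable f P) : Measurable f := by
  have : P.IsComplete := ⟨fun s hs => 𝓕.le 0 _ (h𝓕.complete s hs)⟩
  exact hf.nullMeasurable.measurable_of_complete

end StoppingTimes

section Paths

variable {Ω : Type*} {m : MeasurableSpace Ω} {P : Measure Ω} {𝓕 : Filtration ℝ≥0 m}

/-- The first point strictly after `t` of the grid of mesh `1 / (n + 1)`. -/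
noncomputable def gridTime (n : ℕ) (t : ℝ≥0) : ℝ≥0 := (⌊t * (n + 1)⌋₊ + 1) / (n + 1)

lemma lt_gridTime (n : ℕ) (t : ℝ≥0) : t < gridTime n t := by
  rw [gridTime, lt_div_iff₀ (by positivity)]
  exact Nat.lt_floor_add_one _

lemma gridTime_le (n : ℕ) (t : ℝ≥0) : gridTime n t ≤ t + 1 / (n + 1) := by
  rw [gridTime, add_div]
  gcongr
  rw [div_le_iff₀ (by positivity)]
  exact Nat.floor_le zero_le

lemma tendsto_gridTime (t : ℝ≥0) : Tendsto (fun n => gridTime n t) atTop (𝓝[≥] t) := by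
  refine tendsto_nhdsWithin_iff.mpr ⟨?_, Eventually.of_forall fun n => (lt_gridTime n t).le⟩
  have h : Tendsto (fun n : ℕ => t + 1 / ((n : ℝ≥0) + 1)) atTop (𝓝 (t + 0)) :=
    tendsto_const_nhds.add tendsto_one_div_add_atTop_nhds_zero_nat
  rw [add_zero] at h
  exact tendsto_of_tendsto_of_tendsto_of_le_of_le tendsto_const_nhds h
    (fun n => (lt_gridTime n t).le) (fun n => gridTime_le n t)

lemma RightContPaths.measurable {X : WithTop ℝ≥0 → Ω → ℝ} (hX : RightContPaths X)
    (hm : ∀ t : ℝ≥0, Measurable (X t)) :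
    Measurable fun p : ℝ≥0 × Ω => X (p.1 : WithTop ℝ≥0) p.2 := by
  refine measurable_of_tendsto_metrizable
    (f := fun (n : ℕ) (p : ℝ≥0 × Ω) => X (gridTime n p.1 : WithTop ℝ≥0) p.2) (fun n => ?_) ?_
  · obtain ⟨d, hd⟩ : ∃ d : ℕ → ℝ≥0, ∀ t, gridTime n t = d ⌊t * (n + 1)⌋₊ :=
      ⟨fun k => (k + 1) / (n + 1), fun t => rfl⟩
    have h1 : Measurable fun q : ℕ × Ω => X (d q.1 : WithTop ℝ≥0) q.2 :=
      measurable_from_prod_countable_right fun k => hm (d k)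
    have h2 : Measurable fun p : ℝ≥0 × Ω => (⌊p.1 * (n + 1)⌋₊, p.2) :=
      (Nat.measurable_floor.comp (measurable_fst.mul_const _)).prodMk measurable_snd
    simp only [hd]
    exact h1.comp h2
  · rw [tendsto_pi_nhds]
    exact fun p => (hX p.2 p.1).tendsto.comp (tendsto_gridTime p.1)

lemma RightContPaths.measurable_comp {X : WithTop ℝ≥0 → Ω → ℝ} (hX : RightContPaths X)
    (hm : ∀ t : WithTop ℝ≥0, Measurable (X t)) {α : Type*} {mα : MeasurableSpace α}
    {r : α → WithTop ℝ≥0} {f : α → Ω} (hr : Measurable r) (hf : Measurable f) :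
    Measurable fun a => X (r a) (f a) := by
  have h1 : Measurable fun a => X (((r a).untopD 0 : ℝ≥0) : WithTop ℝ≥0) (f a) :=
    (hX.measurable fun t => hm t).comp ((hr.untopD 0).prodMk hf)
  have h2 : Measurable fun a => X ⊤ (f a) := (hm ⊤).comp hf
  have hs : MeasurableSet {a | r a = ⊤} := hr (measurableSet_singleton ⊤)
  classical
  have h3 : (fun a => X (r a) (f a)) = fun a => if r a = ⊤ then X ⊤ (f a) else
      X (((r a).untopD 0 : ℝ≥0) : WithTop ℝ≥0) (f a) := by
    funext a
    by_cases ha : r a = ⊤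
    · simp [ha]
    · rw [if_neg ha]
      congr 1
      lift r a to ℝ≥0 using ha with s
      rfl
  rw [h3]
  exact Measurable.ite hs h2 h1

variable {L F M : Firm → WithTop ℝ≥0 → Ω → ℝ}

lemma exists_forall_Ico_lt {X Y : WithTop ℝ≥0 → Ω → ℝ} (hX : RightContPaths X)
    (hY : RightContPaths Y) {t : ℝ≥0} {ω : Ω} (h : X t ω < Y t ω) :
    ∃ u : ℝ≥0, t < u ∧ ∀ s : ℝ≥0, t ≤ s → s < u → X s ω < Y s ω := by
  have he : ∀ᶠ s : ℝ≥0 in 𝓝[≥] t, X (s : WithTop ℝ≥0) ω < Y (s : WithTop ℝ≥0) ω :=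
    (hX ω t).tendsto.eventually_lt (hY ω t).tendsto h
  obtain ⟨u, hu, hsub⟩ := mem_nhdsGE_iff_exists_Ico_subset.mp he
  exact ⟨u, hu, fun s hs hs' => hsub ⟨hs, hs'⟩⟩

lemma le_preemptionTime (t : WithTop ℝ≥0) (ω : Ω) : t ≤ preemptionTime L F t ω :=
  le_sInf fun _ hs => hs.1

lemma preemptionTime_le {t : WithTop ℝ≥0} {s : WithTop ℝ≥0} {ω : Ω} (hts : t ≤ s) (hs : s ≠ ⊤)
    (h1 : F .one s ω < L .one s ω) (h2 : F .two s ω < L .two s ω) :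
    preemptionTime L F t ω ≤ s :=
  sInf_le ⟨hts, hs, h1, h2⟩

lemma le_of_preemptionTime_eq (hL : ∀ i, RightContPaths (L i)) (hF : ∀ i, RightContPaths (F i))
    {t : WithTop ℝ≥0} {ω : Ω} (ht : t ≠ ⊤) (h : preemptionTime L F t ω = t) (i : Firm) :
    F i t ω ≤ L i t ω := by
  by_contra! hlt
  lift t to ℝ≥0 using ht
  obtain ⟨u, hu, hsub⟩ := exists_forall_Ico_lt (hL i) (hF i) hlt
  have : (u : WithTop ℝ≥0) ≤ preemptionTime L F t ω := by
    refine le_sInf fun s hs => ?_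
    obtain ⟨hts, hs, h1, h2⟩ := hs
    lift s to ℝ≥0 using hs
    by_contra! hsu
    have := hsub s (by exact_mod_cast hts) (by exact_mod_cast hsu)
    cases i
    · exact lt_asymm this h1
    · exact lt_asymm this h2
  rw [h] at this
  exact absurd hu (not_lt.mpr (by exact_mod_cast this))

lemma preemptionTime_lt_iff (hL : ∀ i, RightContPaths (L i)) (hF : ∀ i, RightContPaths (F i))
    {D : Set ℝ≥0} (hD : Dense D) {t : WithTop ℝ≥0} {b : ℝ≥0} {ω : Ω} :
    preemptionTime L F t ω < b ↔ ∃ q ∈ D, q < b ∧ t ≤ (q : WithTop ℝ≥0) ∧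
      F .one q ω < L .one q ω ∧ F .two q ω < L .two q ω := by
  constructor
  · intro h
    obtain ⟨s, ⟨hts, hs, h1, h2⟩, hsb⟩ := sInf_lt_iff.mp h
    lift s to ℝ≥0 using hs
    obtain ⟨u, hu, hu'⟩ := exists_forall_Ico_lt (hF .one) (hL .one) h1
    obtain ⟨v, hv, hv'⟩ := exists_forall_Ico_lt (hF .two) (hL .two) h2
    have hsb' : s < b := by exact_mod_cast hsb
    obtain ⟨q, hq, hsq, hqb⟩ := hD.exists_between (lt_min hsb' (lt_min hu hv))
    obtain ⟨hqb, hqu, hqv⟩ : q < b ∧ q < u ∧ q < v := by simpa using hqb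
    exact ⟨q, hq, hqb, hts.trans (by exact_mod_cast hsq.le), hu' q hsq.le hqu, hv' q hsq.le hqv⟩
  · rintro ⟨q, -, hqb, htq, h1, h2⟩
    exact (preemptionTime_le htq WithTop.coe_ne_top h1 h2).trans_lt (by exact_mod_cast hqb)

lemma isStoppingTime_preemptionTime (h𝓕 : UsualConditions P 𝓕)
    (hL : ∀ i, RightContPaths (L i)) (hF : ∀ i, RightContPaths (F i))
    (hLm : ∀ i, ∀ t : ℝ≥0, Measurable[𝓕 t] (L i t)) (hFm : ∀ i, ∀ t : ℝ≥0, Measurable[𝓕 t] (F i t))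
    (τ : StopTime 𝓕) : IsStoppingTime 𝓕 fun ω => preemptionTime L F (τ.1 ω) ω := by
  have := h𝓕.rightCont
  refine isStoppingTime_of_measurableSet_lt_of_isRightContinuous fun b => ?_
  obtain ⟨D, hDc, hD⟩ := TopologicalSpace.exists_countable_dense ℝ≥0
  have hu : {ω | preemptionTime L F (τ.1 ω) ω < b} = ⋃ q ∈ D ∩ Set.Iio b,
      ({ω | τ.1 ω ≤ (q : WithTop ℝ≥0)} ∩
        ({ω | F .one q ω < L .one q ω} ∩ {ω | F .two q ω < L .two q ω})) := by
    ext ω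
    simp only [Set.mem_ofPred_eq, preemptionTime_lt_iff hL hF hD, Set.mem_iUnion, Set.mem_inter_iff,
      Set.mem_Iio, exists_prop, and_assoc]
  rw [hu]
  refine MeasurableSet.biUnion (hDc.mono Set.inter_subset_left) fun q hq => ?_
  refine 𝓕.mono (le_of_lt hq.2) _ ?_
  exact (τ.2 q).inter ((measurableSet_lt (hFm _ q) (hLm _ q)).inter
    (measurableSet_lt (hFm _ q) (hLm _ q)))

end Paths

section Values

variable {Ω : Type*} {m : MeasurableSpace Ω} {P : Measure Ω} {𝓕 : Filtration ℝ≥0 m}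

lemma Revenues.Regular.accrued_disB {R : Revenues P 𝓕} {ω : Ω} (h : R.Regular ω)
    (a b : WithTop ℝ≥0) :
    accrued (R.revB .two) a b ω - accrued (R.revF .two) a b ω ≤
      accrued (R.revB .one) a b ω - accrued (R.revF .one) a b ω := by
  rw [← accrued_sub (h.intB _) (h.intF _), ← accrued_sub (h.intB _) (h.intF _)]
  exact accrued_mono ((h.intB _).sub (h.intF _)) ((h.intB _).sub (h.intF _)) h.disB

lemma Revenues.Regular.accrued_disL {R : Revenues P 𝓕} {ω : Ω} (h : R.Regular ω)
    (a b : WithTop ℝ≥0) :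
    accrued (R.revL .two) a b ω - accrued (R.revF .two) a b ω ≤
      accrued (R.revL .one) a b ω - accrued (R.revF .one) a b ω := by
  rw [← accrued_sub (h.intL _) (h.intF _), ← accrued_sub (h.intL _) (h.intF _)]
  exact accrued_mono ((h.intL _).sub (h.intF _)) ((h.intL _).sub (h.intF _)) h.disL

lemma Revenues.Regular.accrued_B_le_L {R : Revenues P 𝓕} {ω : Ω} (h : R.Regular ω) (i : Firm)
    (a b : WithTop ℝ≥0) : accrued (R.revB i) a b ω ≤ accrued (R.revL i) a b ω :=
  accrued_mono (h.intB i) (h.intL i) (h.B_le_L i)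

lemma Revenues.Regular.accrued_F_le_0 {R : Revenues P 𝓕} {ω : Ω} (h : R.Regular ω) (i : Firm)
    (a b : WithTop ℝ≥0) : accrued (R.revF i) a b ω ≤ accrued (R.rev0 i) a b ω :=
  accrued_mono (h.intF i) (h.int0 i) (h.F_le_0 i)

/-- Revenue of firm `i` from `τ` on, if it leads at `τ` and its opponent follows at `σ`. -/
noncomputable def leaderStream (R : Revenues P 𝓕) (i : Firm) (τ σ : StopTime 𝓕) (ω : Ω) : ℝ :=
  accrued (R.revL i) (τ.1 ω) (σ.1 ω) ω + accrued (R.revB i) (σ.1 ω) ⊤ ω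

/-- Revenue of firm `i` from `τ` on, if its opponent leads at `τ` and it follows at `σ`. -/
noncomputable def followerStream (R : Revenues P 𝓕) (i : Firm) (τ σ : StopTime 𝓕) (ω : Ω) : ℝ :=
  accrued (R.revF i) (τ.1 ω) (σ.1 ω) ω + accrued (R.revB i) (σ.1 ω) ⊤ ω

lemma followerGain_eq (R : Revenues P 𝓕) (i : Firm) (τ σ : StopTime 𝓕) :
    followerGain R i τ σ = P[followerStream R i τ σ | τ.info] := rfl

/-- Revenue of firm `i` until `τ`, if nobody has invested before. -/
noncomputable def pastRevenue (R : Revenues P 𝓕) (i : Firm) (τ : StopTime 𝓕) (ω : Ω) : ℝ :=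
  accrued (R.rev0 i) 0 (τ.1 ω) ω

/-- A bound for the revenue of firm `i` after the first investment. -/
noncomputable def Revenues.bound (R : Revenues P 𝓕) (i : Firm) (ω : Ω) : ℝ :=
  total (R.revL i) ω + total (R.revF i) ω + total (R.revB i) ω

/-- At `τ`, the process `X` has the value of expected revenue `Y` from `τ` on. -/
structure IsValue (R : Revenues P 𝓕) (i : Firm) (X : WithTop ℝ≥0 → Ω → ℝ) (τ : StopTime 𝓕)
    (Y : Ω → ℝ) : Prop where
  integrable : Integrable Y P
  le_bound : ∀ᵐ ω ∂P, |Y ω| ≤ R.bound i ω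
  eq : (fun ω => X (τ.1 ω) ω) =ᵐ[P] fun ω => pastRevenue R i τ ω + (P[Y | τ.info]) ω

variable [IsProbabilityMeasure P] {R : Revenues P 𝓕} {i : Firm} {τ σ r : StopTime 𝓕}
  {X X' L F M : WithTop ℝ≥0 → Ω → ℝ} {Y Y' : Ω → ℝ} {A : Set Ω}

lemma integrable_pastRevenue (R : Revenues P 𝓕) (i : Firm) (τ : StopTime 𝓕) :
    Integrable (pastRevenue R i τ) P :=
  (R.isRevenue_rev0 i).integrable_accrued measurable_const τ.measurable

lemma integrable_leaderStream (R : Revenues P 𝓕) (i : Firm) (τ σ : StopTime 𝓕) :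
    Integrable (leaderStream R i τ σ) P :=
  ((R.isRevenue_revL i).integrable_accrued τ.measurable σ.measurable).add
    ((R.isRevenue_revB i).integrable_accrued σ.measurable measurable_const)

lemma integrable_followerStream (R : Revenues P 𝓕) (i : Firm) (τ σ : StopTime 𝓕) :
    Integrable (followerStream R i τ σ) P :=
  ((R.isRevenue_revF i).integrable_accrued τ.measurable σ.measurable).add
    ((R.isRevenue_revB i).integrable_accrued σ.measurable measurable_const)

lemma integrable_accruedB (R : Revenues P 𝓕) (i : Firm) (τ : StopTime 𝓕) :
    Integrable (fun ω => accrued (R.revB i) (τ.1 ω) ⊤ ω) P :=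
  (R.isRevenue_revB i).integrable_accrued τ.measurable measurable_const

lemma Revenues.integrable_bound (R : Revenues P 𝓕) (i : Firm) : Integrable (R.bound i) P :=
  ((R.isRevenue_revL i).integrable_total.add (R.isRevenue_revF i).integrable_total).add
    (R.isRevenue_revB i).integrable_total

lemma IsValue.integrable_value (h : IsValue R i X τ Y) : Integrable (fun ω => X (τ.1 ω) ω) P :=
  ((integrable_pastRevenue R i τ).add integrable_condExp).congr h.eq.symm

lemma IsValue.setIntegral_eq (h : IsValue R i X τ Y) (hA : MeasurableSet[τ.info] A) :
    ∫ ω in A, X (τ.1 ω) ω ∂P = ∫ ω in A, (pastRevenue R i τ ω + Y ω) ∂P := by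
  rw [setIntegral_congr_ae (τ.info_le _ hA) (h.eq.mono fun ω h _ => h),
    integral_add (integrable_pastRevenue R i τ).integrableOn integrable_condExp.integrableOn,
    integral_add (integrable_pastRevenue R i τ).integrableOn h.integrable.integrableOn,
    setIntegral_condExp τ.info_le h.integrable hA]

lemma IsValue.mono (h : IsValue R i X τ Y) (h' : IsValue R i X' τ Y') (hY : Y ≤ᵐ[P] Y') :
    ∀ᵐ ω ∂P, X (τ.1 ω) ω ≤ X' (τ.1 ω) ω := by
  filter_upwards [h.eq, h'.eq, condExp_mono (m := τ.info) h.integrable h'.integrable hY]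
    with ω h1 h2 h3
  rw [h1, h2]
  exact add_le_add_right h3 _

lemma IsValue.abs_value_le (h : IsValue R i X τ Y) :
    ∀ᵐ ω ∂P, |X (τ.1 ω) ω| ≤ total (R.rev0 i) ω + (P[R.bound i | τ.info]) ω := by
  have h1 := condExp_mono (m := τ.info) h.integrable (R.integrable_bound i)
    (h.le_bound.mono fun ω h => (abs_le.mp h).2)
  have h2 := condExp_mono (m := τ.info) (R.integrable_bound i).neg h.integrable
    (h.le_bound.mono fun ω h => (abs_le.mp h).1)
  filter_upwards [h.eq, h1, h2, condExp_neg (μ := P) (R.bound i) τ.info, R.ae_regular]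
    with ω h3 h4 h5 h6 h7
  rw [h3]
  rw [h6] at h5
  exact (abs_add_le _ _).trans (add_le_add (abs_accrued_le (h7.int0 i)) (abs_le.mpr ⟨h5, h4⟩))

lemma IsValue.measurable (h𝓕 : UsualConditions P 𝓕) {t : ℝ≥0}
    (h : IsValue R i X (StopTime.const 𝓕 t) Y) : Measurable[𝓕 t] (X t) := by
  refine h𝓕.measurable_congr ?_ h.eq
  refine ((R.isRevenue_rev0 i).adapted t).add ?_
  rw [← StopTime.info_const (𝓕 := 𝓕) t]
  exact stronglyMeasurable_condExp.measurable

lemma ae_abs_followerStream_le (R : Revenues P 𝓕) (i : Firm) (τ σ : StopTime 𝓕) :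
    ∀ᵐ ω ∂P, |followerStream R i τ σ ω| ≤ R.bound i ω := by
  filter_upwards [R.ae_regular] with ω h
  refine (abs_accrued_add_le (h.intF i) (h.intB i)).trans ?_
  have : 0 ≤ total (R.revL i) ω := total_nonneg
  rw [Revenues.bound]
  linarith

lemma ae_abs_leaderStream_le (R : Revenues P 𝓕) (i : Firm) (τ σ : StopTime 𝓕) :
    ∀ᵐ ω ∂P, |leaderStream R i τ σ ω| ≤ R.bound i ω := by
  filter_upwards [R.ae_regular] with ω h
  refine (abs_accrued_add_le (h.intL i) (h.intB i)).trans ?_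
  have : 0 ≤ total (R.revF i) ω := total_nonneg
  rw [Revenues.bound]
  linarith

lemma IsLeaderPayoff.isValue {τF : Firm → StopTime 𝓕 → StopTime 𝓕}
    (hL : IsLeaderPayoff R τF i L) (τ : StopTime 𝓕) :
    IsValue R i L τ (leaderStream R i τ (τF i.other τ)) where
  integrable := integrable_leaderStream _ _ _ _
  le_bound := ae_abs_leaderStream_le _ _ _ _
  eq := hL.2 τ

lemma IsSimultaneousPayoff.isValue (hM : IsSimultaneousPayoff R i M) (τ : StopTime 𝓕) :
    IsValue R i M τ (fun ω => accrued (R.revB i) (τ.1 ω) ⊤ ω) where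
  integrable := integrable_accruedB _ _ _
  le_bound := by
    filter_upwards [R.ae_regular] with ω h
    refine (abs_accrued_le (h.intB i)).trans ?_
    have h1 : 0 ≤ total (R.revF i) ω := total_nonneg
    have h2 : 0 ≤ total (R.revL i) ω := total_nonneg
    rw [Revenues.bound]
    linarith
  eq := hM.2 τ

lemma IsFollowerPayoff.le (hF : IsFollowerPayoff R i F) (h : τ.1 ≤ᵐ[P] σ.1) :
    ∀ᵐ ω ∂P, pastRevenue R i τ ω + followerGain R i τ σ ω ≤ F (τ.1 ω) ω := by
  filter_upwards [(hF.2 τ).le _ ⟨σ, h, rfl⟩] with ω h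
  change _ ≤ F (τ.1 ω) ω - pastRevenue R i τ ω at h
  linarith

lemma IsFollowerPayoff.isValue (hF : IsFollowerPayoff R i F)
    (h : IsOptimalFollowerTime R i τ σ) : IsValue R i F τ (followerStream R i τ σ) where
  integrable := integrable_followerStream _ _ _ _
  le_bound := ae_abs_followerStream_le _ _ _ _
  eq := by
    have h1 := (hF.2 τ).least (followerGain R i τ σ)
      (stronglyMeasurable_condExp.mono τ.info_le).measurable.aemeasurable (by
        rintro _ ⟨τ', hτ', rfl⟩
        exact h.2 τ' hτ')
    filter_upwards [hF.le h.1, h1] with ω h2 h3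
    change F (τ.1 ω) ω - pastRevenue R i τ ω ≤ _ at h3
    rw [← followerGain_eq]
    linarith

lemma IsFollowerPayoff.setIntegral_le (hF : IsFollowerPayoff R i F)
    (hv : Integrable (fun ω => F (τ.1 ω) ω) P)
    (h : τ.1 ≤ᵐ[P] σ.1) (hA : MeasurableSet[τ.info] A) :
    ∫ ω in A, (pastRevenue R i τ ω + followerStream R i τ σ ω) ∂P ≤ ∫ ω in A, F (τ.1 ω) ω ∂P := by
  rw [integral_add (integrable_pastRevenue R i τ).integrableOn
    (integrable_followerStream R i τ σ).integrableOn,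
    ← setIntegral_condExp τ.info_le (integrable_followerStream R i τ σ) hA,
    ← integral_add (integrable_pastRevenue R i τ).integrableOn integrable_condExp.integrableOn]
  exact setIntegral_mono_ae ((integrable_pastRevenue R i τ).add integrable_condExp).integrableOn
    hv.integrableOn (hF.le h)

lemma simultaneous_le_leader {τF : Firm → StopTime 𝓕 → StopTime 𝓕}
    (hτF : τ.1 ≤ᵐ[P] (τF i.other τ).1) (hM : IsSimultaneousPayoff R i M)
    (hL : IsLeaderPayoff R τF i L) : ∀ᵐ ω ∂P, M (τ.1 ω) ω ≤ L (τ.1 ω) ω := by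
  refine (hM.isValue τ).mono (hL.isValue τ) ?_
  filter_upwards [R.ae_regular, hτF] with ω h hle
  rw [leaderStream, ← accrued_add (h.intB i) hle le_top]
  exact add_le_add_left (h.accrued_B_le_L i _ _) _

lemma followerStream_self (R : Revenues P 𝓕) (i : Firm) (τ : StopTime 𝓕) :
    followerStream R i τ τ = fun ω => accrued (R.revB i) (τ.1 ω) ⊤ ω := by
  funext ω
  rw [followerStream, accrued_eq_zero le_rfl, zero_add]

lemma simultaneous_le_follower (hM : IsSimultaneousPayoff R i M) (hF : IsFollowerPayoff R i F)
    (τ : StopTime 𝓕) : ∀ᵐ ω ∂P, M (τ.1 ω) ω ≤ F (τ.1 ω) ω := by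
  filter_upwards [(hM.isValue τ).eq, hF.le (EventuallyLE.refl _ τ.1)] with ω h1 h2
  rwa [followerGain_eq, followerStream_self, ← h1] at h2

lemma IsFollowerTime.le_of_disadvantage {a b : StopTime 𝓕} (ha : IsFollowerTime R .one τ a)
    (hb : IsFollowerTime R .two τ b) : a.1 ≤ᵐ[P] b.1 := by
  have hc : IsOptimalFollowerTime R .two τ (b.later a) := by
    refine ⟨hb.1.1.trans (Eventually.of_forall fun ω => le_max_left _ _), fun τ' hτ' => ?_⟩
    refine (hb.1.2 τ' hτ').trans ?_
    let d : StopTime 𝓕 := ⟨fun ω => min (a.1 ω) (b.1 ω), a.2.min b.2⟩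
    have hd : followerGain R .one τ d ≤ᵐ[P] followerGain R .one τ a := by
      refine ha.1.2 d ?_
      filter_upwards [ha.1.1, hb.1.1] with ω h1 h2 using le_min h1 h2
    have hs : (fun ω => followerStream R .one τ a ω - followerStream R .one τ d ω) ≤ᵐ[P]
        fun ω => followerStream R .two τ (b.later a) ω - followerStream R .two τ b ω := by
      filter_upwards [R.ae_regular, ha.1.1, hb.1.1] with ω h h1 h2
      rcases le_total (a.1 ω) (b.1 ω) with hab | hab
      · have e1 : d.1 ω = a.1 ω := min_eq_left hab
        have e2 : (b.later a).1 ω = b.1 ω := max_eq_left hab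
        simp only [followerStream, e1, e2, sub_self, le_refl]
      · have e1 : d.1 ω = b.1 ω := min_eq_right hab
        have e2 : (b.later a).1 ω = a.1 ω := max_eq_right hab
        simp only [followerStream, e1, e2]
        rw [← accrued_add (h.intF .one) h2 hab, ← accrued_add (h.intF .two) h2 hab,
          ← accrued_add (h.intB .one) hab le_top, ← accrued_add (h.intB .two) hab le_top]
        linarith [h.accrued_disB (b.1 ω) (a.1 ω)]
    have hE := condExp_mono (m := τ.info)
      ((integrable_followerStream R .one τ a).sub (integrable_followerStream R .one τ d))
      ((integrable_followerStream R .two τ (b.later a)).sub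
        (integrable_followerStream R .two τ b)) hs
    filter_upwards [hd, hE, condExp_sub (integrable_followerStream R .one τ a)
      (integrable_followerStream R .one τ d) τ.info,
      condExp_sub (integrable_followerStream R .two τ (b.later a))
      (integrable_followerStream R .two τ b) τ.info] with ω h1 h2 h3 h4
    change P[followerStream R .one τ a - followerStream R .one τ d | τ.info] ω ≤
      P[followerStream R .two τ (b.later a) - followerStream R .two τ b | τ.info] ω at h2
    rw [h3, h4] at h2
    simp only [followerGain_eq, Pi.sub_apply] at h1 h2 ⊢
    linarith
  filter_upwards [hb.2 _ hc] with ω h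
  exact (le_max_right _ _).trans h

lemma leader_advantage_le {τF : Firm → StopTime 𝓕 → StopTime 𝓕}
    (hτF : ∀ i τ, IsFollowerTime R i τ (τF i τ)) {L F : Firm → WithTop ℝ≥0 → Ω → ℝ}
    (hL : ∀ i, IsLeaderPayoff R τF i (L i)) (hF : ∀ i, IsFollowerPayoff R i (F i))
    (τ : StopTime 𝓕) :
    ∀ᵐ ω ∂P, L .two (τ.1 ω) ω - F .two (τ.1 ω) ω ≤ L .one (τ.1 ω) ω - F .one (τ.1 ω) ω := by
  set a := τF .one τ with ha
  set b := τF .two τ with hb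
  have hs : (fun ω => leaderStream R .two τ a ω - followerStream R .two τ a ω) ≤ᵐ[P]
      fun ω => leaderStream R .one τ b ω - followerStream R .one τ a ω := by
    filter_upwards [R.ae_regular, (hτF .one τ).1.1,
      (hτF .one τ).le_of_disadvantage (hτF .two τ)] with ω h h1 h2
    simp only [leaderStream, followerStream]
    rw [← accrued_add (h.intL .one) h1 h2, ← accrued_add (h.intB .one) h2 le_top]
    linarith [h.accrued_disL (τ.1 ω) (a.1 ω), h.accrued_B_le_L .one (a.1 ω) (b.1 ω)]
  have hE := condExp_mono (m := τ.info)
    ((integrable_leaderStream R .two τ a).sub (integrable_followerStream R .two τ a))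
    ((integrable_leaderStream R .one τ b).sub (integrable_followerStream R .one τ a)) hs
  filter_upwards [hE, condExp_sub (integrable_leaderStream R .two τ a)
      (integrable_followerStream R .two τ a) τ.info,
      condExp_sub (integrable_leaderStream R .one τ b)
      (integrable_followerStream R .one τ a) τ.info,
      ((hL .one).isValue τ).eq, ((hL .two).isValue τ).eq,
      ((hF .one).isValue (hτF .one τ).1).eq,
      (hF .two).le (hτF .one τ).1.1] with ω h1 h2 h3 h4 h5 h6 h7
  change P[leaderStream R .two τ a - followerStream R .two τ a | τ.info] ω ≤
    P[leaderStream R .one τ b - followerStream R .one τ a | τ.info] ω at h1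
  rw [h2, h3] at h1
  simp only [followerGain_eq, Pi.sub_apply, Firm.other] at h1 h4 h5 h6 h7 ⊢
  linarith

end Values

section Deviations

variable {Ω : Type*} {m : MeasurableSpace Ω} {P : Measure Ω} {𝓕 : Filtration ℝ≥0 m}

/-- The properties of the payoff processes of firm `i` on which its incentives depend. -/
structure FirmPayoffs (R : Revenues P 𝓕) (i : Firm) (L F M S : WithTop ℝ≥0 → Ω → ℝ) : Prop where
  follower : IsFollowerPayoff R i F
  exists_optimal : ∀ τ : StopTime 𝓕, ∃ σ, IsOptimalFollowerTime R i τ σ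
  leader : ∀ τ : StopTime 𝓕, ∃ Y, IsValue R i L τ Y
  simultaneous : IsSimultaneousPayoff R i M
  sim_le_leader : ∀ τ : StopTime 𝓕, ∀ᵐ ω ∂P, M (τ.1 ω) ω ≤ L (τ.1 ω) ω
  sim_le : ∀ τ : StopTime 𝓕, ∀ᵐ ω ∂P, M (τ.1 ω) ω ≤ S (τ.1 ω) ω
  le_follower : ∀ τ : StopTime 𝓕, ∀ᵐ ω ∂P, L (τ.1 ω) ω ≤ F (τ.1 ω) ω →
    S (τ.1 ω) ω ≤ F (τ.1 ω) ω
  le_leader : ∀ τ : StopTime 𝓕, ∀ᵐ ω ∂P, L (τ.1 ω) ω < F (τ.1 ω) ω →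
    S (τ.1 ω) ω ≤ L (τ.1 ω) ω
  aemeasurable : ∀ τ : StopTime 𝓕, AEMeasurable (fun ω => S (τ.1 ω) ω) P
  mem : ∀ t ω, S t ω = L t ω ∨ S t ω = F t ω ∨ S t ω = M t ω
  measurable_follower : ∀ t, Measurable (F t)

variable [IsProbabilityMeasure P] {R : Revenues P 𝓕} {i : Firm} {τ σ r : StopTime 𝓕}
  {L F M S : WithTop ℝ≥0 → Ω → ℝ} {A D : Set Ω}

/-- A bound for the total revenue of firm `i`. -/
noncomputable def Revenues.totalBound (R : Revenues P 𝓕) (i : Firm) (ω : Ω) : ℝ :=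
  total (R.rev0 i) ω + R.bound i ω

lemma Revenues.integrable_totalBound (R : Revenues P 𝓕) (i : Firm) :
    Integrable (R.totalBound i) P :=
  (R.isRevenue_rev0 i).integrable_total.add (R.integrable_bound i)

/-- The bound for the value at `τ` of expected revenues. -/
noncomputable def Revenues.valueBound (R : Revenues P 𝓕) (i : Firm) (τ : StopTime 𝓕) (ω : Ω) : ℝ :=
  total (R.rev0 i) ω + (P[R.bound i | τ.info]) ω

lemma Revenues.integrable_valueBound (R : Revenues P 𝓕) (i : Firm) (τ : StopTime 𝓕) :
    Integrable (R.valueBound i τ) P :=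
  (R.isRevenue_rev0 i).integrable_total.add integrable_condExp

lemma Revenues.setIntegral_valueBound (R : Revenues P 𝓕) (i : Firm) (τ : StopTime 𝓕)
    (hA : MeasurableSet[τ.info] A) :
    ∫ ω in A, R.valueBound i τ ω ∂P = ∫ ω in A, R.totalBound i ω ∂P := by
  simp only [valueBound, totalBound]
  rw [integral_add (R.isRevenue_rev0 i).integrable_total.integrableOn
      integrable_condExp.integrableOn,
    integral_add (R.isRevenue_rev0 i).integrable_total.integrableOn
      (R.integrable_bound i).integrableOn,
    setIntegral_condExp τ.info_le (R.integrable_bound i) hA]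

namespace FirmPayoffs

lemma integrable_leader (h : FirmPayoffs R i L F M S) (τ : StopTime 𝓕) :
    Integrable (fun ω => L (τ.1 ω) ω) P :=
  (h.leader τ).choose_spec.integrable_value

lemma integrable_follower (h : FirmPayoffs R i L F M S) (τ : StopTime 𝓕) :
    Integrable (fun ω => F (τ.1 ω) ω) P :=
  (h.follower.isValue (h.exists_optimal τ).choose_spec).integrable_value

lemma integrable_sim (h : FirmPayoffs R i L F M S) (τ : StopTime 𝓕) :
    Integrable (fun ω => M (τ.1 ω) ω) P :=
  (h.simultaneous.isValue τ).integrable_value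

lemma abs_leader_le (h : FirmPayoffs R i L F M S) (τ : StopTime 𝓕) :
    ∀ᵐ ω ∂P, |L (τ.1 ω) ω| ≤ R.valueBound i τ ω :=
  (h.leader τ).choose_spec.abs_value_le

lemma abs_follower_le (h : FirmPayoffs R i L F M S) (τ : StopTime 𝓕) :
    ∀ᵐ ω ∂P, |F (τ.1 ω) ω| ≤ R.valueBound i τ ω :=
  (h.follower.isValue (h.exists_optimal τ).choose_spec).abs_value_le

lemma abs_le (h : FirmPayoffs R i L F M S) (τ : StopTime 𝓕) :
    ∀ᵐ ω ∂P, |S (τ.1 ω) ω| ≤ R.valueBound i τ ω := by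
  filter_upwards [h.abs_leader_le τ, h.abs_follower_le τ,
    (h.simultaneous.isValue τ).abs_value_le] with ω h1 h2 h3
  rcases h.mem (τ.1 ω) ω with e | e | e <;> rw [e]
  exacts [h1, h2, h3]

lemma integrable (h : FirmPayoffs R i L F M S) (τ : StopTime 𝓕) :
    Integrable (fun ω => S (τ.1 ω) ω) P :=
  (R.integrable_valueBound i τ).mono' (h.aemeasurable τ).aestronglyMeasurable (h.abs_le τ)

lemma integral_abs_follower_le (h : FirmPayoffs R i L F M S) (τ : StopTime 𝓕) :
    ∫ ω, |F (τ.1 ω) ω| ∂P ≤ ∫ ω, R.totalBound i ω ∂P := by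
  have := R.setIntegral_valueBound i τ MeasurableSet.univ
  rw [setIntegral_univ, setIntegral_univ] at this
  rw [← this]
  exact integral_mono_ae (h.integrable_follower τ).abs (R.integrable_valueBound i τ)
    (h.abs_follower_le τ)

end FirmPayoffs

lemma measurableSet_lt_stop (a b : StopTime 𝓕) : MeasurableSet {ω | a.1 ω < b.1 ω} :=
  measurableSet_lt a.measurable b.measurable

lemma measurableSet_eq_stop (a b : StopTime 𝓕) : MeasurableSet {ω | a.1 ω = b.1 ω} :=
  measurableSet_eq_fun a.measurable b.measurable

lemma setIntegral_trichotomy {g : Ω → ℝ} (hg : Integrable g P) (hA : MeasurableSet A)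
    (a b : StopTime 𝓕) :
    ∫ ω in A, g ω ∂P = ∫ ω in A ∩ {ω | a.1 ω < b.1 ω}, g ω ∂P +
      ∫ ω in A ∩ {ω | b.1 ω < a.1 ω}, g ω ∂P + ∫ ω in A ∩ {ω | a.1 ω = b.1 ω}, g ω ∂P := by
  have hd1 : Disjoint (A ∩ {ω | a.1 ω < b.1 ω}) (A ∩ {ω | b.1 ω < a.1 ω}) :=
    Set.disjoint_left.mpr fun ω h h' =>
      lt_asymm (a := a.1 ω) (b := b.1 ω) h.2 h'.2
  have hd2 : Disjoint (A ∩ {ω | a.1 ω < b.1 ω} ∪ A ∩ {ω | b.1 ω < a.1 ω})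
      (A ∩ {ω | a.1 ω = b.1 ω}) := by
    refine Set.disjoint_left.mpr fun ω h h' => ?_
    rcases h with h | h
    · exact h.2.ne h'.2
    · exact h.2.ne' h'.2
  rw [← setIntegral_union hd1 (hA.inter (measurableSet_lt_stop b a)) hg.integrableOn
      hg.integrableOn,
    ← setIntegral_union hd2 (hA.inter (measurableSet_eq_stop a b)) hg.integrableOn
      hg.integrableOn]
  congr 2
  ext ω
  have := lt_trichotomy (a.1 ω) (b.1 ω)
  simp only [Set.mem_union, Set.mem_inter_iff, Set.mem_ofPred_eq]
  tauto

/-- The realized payoff of the pure plan `τ` against the pure plan `r`. -/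
noncomputable def realized (L F S : WithTop ℝ≥0 → Ω → ℝ) (τ r : StopTime 𝓕) (ω : Ω) : ℝ :=
  outcome L F S (τ.1 ω) (r.1 ω) ω

lemma outcome_of_lt {a b : WithTop ℝ≥0} {ω : Ω} (h : a < b) : outcome L F S a b ω = L a ω :=
  if_pos h

lemma outcome_of_gt {a b : WithTop ℝ≥0} {ω : Ω} (h : b < a) : outcome L F S a b ω = F b ω := by
  rw [outcome, if_neg h.not_gt, if_pos h]

lemma outcome_of_eq {a b : WithTop ℝ≥0} {ω : Ω} (h : a = b) : outcome L F S a b ω = S a ω := by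
  subst h
  rw [outcome, if_neg (lt_irrefl _), if_neg (lt_irrefl _)]

lemma abs_outcome_le (a b : WithTop ℝ≥0) (ω : Ω) :
    |outcome L F S a b ω| ≤ |L a ω| + |F b ω| + |S a ω| := by
  have h1 := abs_nonneg (L a ω)
  have h2 := abs_nonneg (F b ω)
  have h3 := abs_nonneg (S a ω)
  rcases lt_trichotomy a b with h | h | h
  · rw [outcome_of_lt h]; linarith
  · rw [outcome_of_eq h]; linarith
  · rw [outcome_of_gt h]; linarith

lemma aemeasurable_outcome {α : Type*} {mα : MeasurableSpace α} {μ : Measure α}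
    {a b : α → WithTop ℝ≥0} {w : α → Ω} (ha : Measurable a) (hb : Measurable b)
    (h1 : AEMeasurable (fun x => L (a x) (w x)) μ) (h2 : AEMeasurable (fun x => F (b x) (w x)) μ)
    (h3 : AEMeasurable (fun x => S (a x) (w x)) μ) :
    AEMeasurable (fun x => outcome L F S (a x) (b x) (w x)) μ := by
  have e : (fun x => outcome L F S (a x) (b x) (w x)) =
      ({x | a x < b x}.indicator (fun x => L (a x) (w x)) +
        {x | b x < a x}.indicator (fun x => F (b x) (w x))) +
        {x | a x = b x}.indicator (fun x => S (a x) (w x)) := by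
    funext x
    rcases lt_trichotomy (a x) (b x) with h | h | h
    · simp [outcome_of_lt h, h, h.not_gt, h.ne]
    · rw [outcome_of_eq h]
      simp [h]
    · simp [outcome_of_gt h, h, h.not_gt, h.ne']
  rw [e]
  exact ((h1.indicator (measurableSet_lt ha hb)).add (h2.indicator (measurableSet_lt hb ha))).add
    (h3.indicator (measurableSet_eq_fun ha hb))

namespace FirmPayoffs

lemma integrable_realized (h : FirmPayoffs R i L F M S) (τ r : StopTime 𝓕) :
    Integrable (realized L F S τ r) P := by
  refine (((h.integrable_leader τ).abs.add (h.integrable_follower r).abs).add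
    (h.integrable τ).abs).mono' ?_ (Eventually.of_forall fun ω => abs_outcome_le _ _ _)
  exact (aemeasurable_outcome τ.measurable r.measurable (h.integrable_leader τ).aemeasurable
    (h.integrable_follower r).aemeasurable (h.aemeasurable τ)).aestronglyMeasurable

lemma setIntegral_realized (h : FirmPayoffs R i L F M S) (τ r : StopTime 𝓕)
    (hA : MeasurableSet A) :
    ∫ ω in A, realized L F S τ r ω ∂P = ∫ ω in A ∩ {ω | τ.1 ω < r.1 ω}, L (τ.1 ω) ω ∂P +
      ∫ ω in A ∩ {ω | r.1 ω < τ.1 ω}, F (r.1 ω) ω ∂P +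
      ∫ ω in A ∩ {ω | τ.1 ω = r.1 ω}, S (τ.1 ω) ω ∂P := by
  rw [setIntegral_trichotomy (h.integrable_realized τ r) hA τ r]
  congr 1
  · congr 1
    · exact setIntegral_congr_fun (hA.inter (measurableSet_lt_stop _ _))
        fun ω hω => outcome_of_lt hω.2
    · exact setIntegral_congr_fun (hA.inter (measurableSet_lt_stop _ _))
        fun ω hω => outcome_of_gt hω.2
  · exact setIntegral_congr_fun (hA.inter (measurableSet_eq_stop _ _))
      fun ω hω => outcome_of_eq hω.2

/-- Planned investment at `σ` yields at least what is obtained by following an immediate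
investment of the opponent at `σ`. -/
lemma follow_le_setIntegral_realized (h : FirmPayoffs R i L F M S)
    (hA : MeasurableSet[τ.info] A) (hr : ∀ ω ∈ A, τ.1 ω ≤ r.1 ω) (hσ : ∀ ω ∈ A, τ.1 ω ≤ σ.1 ω) :
    ∫ ω in A, (pastRevenue R i τ ω + followerStream R i τ σ ω) ∂P ≤
      ∫ ω in A, realized L F S σ r ω ∂P := by
  have hg : Integrable (fun ω => pastRevenue R i τ ω + followerStream R i τ σ ω) P :=
    (integrable_pastRevenue R i τ).add (integrable_followerStream R i τ σ)
  have hAm : MeasurableSet A := τ.info_le _ hA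
  have hAσ := StopTime.measurableSet_of_le hA hσ
  have hAr := StopTime.measurableSet_of_le hA hr
  rw [h.setIntegral_realized σ r hAm, setIntegral_trichotomy hg hAm σ r]
  have key : ∀ E : Set Ω, MeasurableSet[σ.info] E → E ⊆ A →
      ∫ ω in E, (pastRevenue R i τ ω + followerStream R i τ σ ω) ∂P ≤
        ∫ ω in E, M (σ.1 ω) ω ∂P := by
    intro E hE hEA
    rw [(h.simultaneous.isValue σ).setIntegral_eq hE]
    refine setIntegral_mono_on_ae hg.integrableOn
      ((integrable_pastRevenue R i σ).add (integrable_accruedB R i σ)).integrableOn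
      (σ.info_le _ hE) ?_
    filter_upwards [R.ae_regular] with ω hω hωE
    rw [pastRevenue, pastRevenue, followerStream,
      ← accrued_add (hω.int0 i) (zero_le (a := τ.1 ω)) (hσ ω (hEA hωE))]
    linarith [hω.accrued_F_le_0 i (τ.1 ω) (σ.1 ω)]
  refine add_le_add (add_le_add ?_ ?_) ?_
  · have hE : MeasurableSet[σ.info] (A ∩ {ω | σ.1 ω < r.1 ω}) :=
      hAσ.inter (σ.measurableSet_lt_left r)
    refine (key _ hE Set.inter_subset_left).trans ?_
    exact setIntegral_mono_ae (h.integrable_sim σ).integrableOn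
      (h.integrable_leader σ).integrableOn (h.sim_le_leader σ)
  · have hE : MeasurableSet[r.info] (A ∩ {ω | r.1 ω < σ.1 ω}) :=
      hAr.inter (r.measurableSet_lt_left σ)
    refine le_trans ?_ (h.follower.setIntegral_le (h.integrable_follower r)
      (σ := r.later σ) (Eventually.of_forall fun ω => le_max_left _ _) hE)
    refine setIntegral_mono_on_ae hg.integrableOn
      ((integrable_pastRevenue R i r).add (integrable_followerStream R i r _)).integrableOn
      (r.info_le _ hE) ?_
    filter_upwards [R.ae_regular] with ω hω hωE
    have e : (r.later σ).1 ω = σ.1 ω := max_eq_right (le_of_lt hωE.2)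
    rw [pastRevenue, pastRevenue, followerStream, followerStream, e,
      ← accrued_add (hω.int0 i) (zero_le (a := τ.1 ω)) (hr ω hωE.1),
      ← accrued_add (hω.intF i) (hr ω hωE.1) (le_of_lt hωE.2)]
    linarith [hω.accrued_F_le_0 i (τ.1 ω) (r.1 ω)]
  · have hE : MeasurableSet[σ.info] (A ∩ {ω | σ.1 ω = r.1 ω}) :=
      hAσ.inter (σ.2.measurableSet_eq_stopping_time r.2)
    refine (key _ hE Set.inter_subset_left).trans ?_
    exact setIntegral_mono_ae (h.integrable_sim σ).integrableOn
      (h.integrable σ).integrableOn (h.sim_le σ)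

/-- The gain from postponing investment on `A` from `τ` to a time `σ` at which it would be optimal
to follow. -/
lemma gain_paste_le (h : FirmPayoffs R i L F M S) (hA : MeasurableSet[τ.info] A)
    (hA' : MeasurableSet[σ.info] A) (hσ : ∀ ω ∈ A, τ.1 ω ≤ σ.1 ω) (hD : MeasurableSet D) (hDA : MeasurableSet[τ.info] (D ∩ A))
    (hopt : ∀ E ⊆ A, MeasurableSet[τ.info] E →
      ∫ ω in E, F (τ.1 ω) ω ∂P ≤ ∫ ω in E, (pastRevenue R i τ ω + followerStream R i τ σ ω) ∂P)
    {U : Ω → ℝ} (hUi : Integrable U P)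
    (hU : ∀ᵐ ω ∂P, ω ∈ A → τ.1 ω ≤ r.1 ω → realized L F S τ r ω ≤ U ω) :
    ∫ ω in (D ∩ A) ∩ {ω | τ.1 ω ≤ r.1 ω}, (F (τ.1 ω) ω - U ω) ∂P ≤
      ∫ ω in D, realized L F S (τ.paste σ A hA hA') r ω ∂P - ∫ ω in D, realized L F S τ r ω ∂P := by
  set ρ := τ.paste σ A hA hA' with hρ
  set E := (D ∩ A) ∩ {ω | τ.1 ω ≤ r.1 ω} with hEdef
  have hE : MeasurableSet[τ.info] E := hDA.inter (τ.measurableSet_le_left r)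
  have hEm : MeasurableSet E := τ.info_le _ hE
  have hi1 := h.integrable_realized ρ r
  have hi2 := h.integrable_realized τ r
  have h1 : ∫ ω in D, (realized L F S ρ r ω - realized L F S τ r ω) ∂P =
      ∫ ω in E, (realized L F S ρ r ω - realized L F S τ r ω) ∂P := by
    refine setIntegral_eq_of_subset_of_forall_sdiff_eq_zero hD (fun ω hω => hω.1.1) fun ω hω => ?_
    by_cases hωA : ω ∈ A
    · have hlt : r.1 ω < τ.1 ω := by
        by_contra! hle
        exact hω.2 ⟨⟨hω.1, hωA⟩, hle⟩
      rw [realized, realized, outcome_of_gt hlt,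
        outcome_of_gt (hlt.trans_le (StopTime.le_paste hA hA' hσ ω)), sub_self]
    · rw [realized, realized, hρ, StopTime.paste_of_notMem hA hA' hωA, sub_self]
  have h2 : ∫ ω in E, realized L F S ρ r ω ∂P = ∫ ω in E, realized L F S σ r ω ∂P := by
    refine setIntegral_congr_fun hEm fun ω hω => ?_
    change outcome _ _ _ _ _ _ = outcome _ _ _ _ _ _
    rw [hρ, StopTime.paste_of_mem hA hA' hω.1.2]
  have h3 : ∫ ω in E, realized L F S τ r ω ∂P ≤ ∫ ω in E, U ω ∂P :=
    setIntegral_mono_on_ae hi2.integrableOn hUi.integrableOn hEm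
      (hU.mono fun ω hω hωE => hω hωE.1.2 hωE.2)
  have h4 := hopt E (fun ω hω => hω.1.2) hE
  have h5 := h.follow_le_setIntegral_realized (τ := τ) (σ := σ) (r := r) hE (fun ω hω => hω.2)
    (fun ω hω => hσ ω hω.1.2)
  rw [← integral_sub hi1.integrableOn hi2.integrableOn, h1,
    integral_sub hi1.integrableOn hi2.integrableOn, h2,
    integral_sub (h.integrable_follower τ).integrableOn hUi.integrableOn]
  linarith

lemma setIntegral_realized_le (h : FirmPayoffs R i L F M S) {ϑ : StopTime 𝓕}
    (hτ : ϑ.1 ≤ᵐ[P] τ.1) (hr : ϑ.1 ≤ᵐ[P] r.1) (hA : MeasurableSet[ϑ.info] A) :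
    ∫ ω in A, realized L F S τ r ω ∂P ≤ ∫ ω in A, R.totalBound i ω ∂P := by
  set B := A ∩ ({ω | ϑ.1 ω ≤ τ.1 ω} ∩ {ω | ϑ.1 ω ≤ r.1 ω}) with hB
  have hBϑ : MeasurableSet[ϑ.info] B :=
    hA.inter ((ϑ.measurableSet_le_left τ).inter (ϑ.measurableSet_le_left r))
  have hBm : MeasurableSet B := ϑ.info_le _ hBϑ
  have hBτ := StopTime.measurableSet_of_le (σ := τ) hBϑ fun ω hω => hω.2.1
  have hBr := StopTime.measurableSet_of_le (σ := r) hBϑ fun ω hω => hω.2.2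
  have hAB : A =ᵐ[P] B := by
    filter_upwards [hτ, hr] with ω h1 h2
    refine propext ⟨fun h => ⟨h, h1, h2⟩, fun h => h.1⟩
  rw [setIntegral_congr_set hAB, setIntegral_congr_set hAB, h.setIntegral_realized τ r hBm,
    setIntegral_trichotomy (R.integrable_totalBound i) hBm τ r]
  refine add_le_add (add_le_add ?_ ?_) ?_
  · rw [← R.setIntegral_valueBound i τ (hBτ.inter (τ.measurableSet_lt_left r))]
    exact setIntegral_mono_ae (h.integrable_leader τ).integrableOn
      (R.integrable_valueBound i τ).integrableOn
      ((h.abs_leader_le τ).mono fun ω hω => (le_abs_self _).trans hω)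
  · rw [← R.setIntegral_valueBound i r (hBr.inter (r.measurableSet_lt_left τ))]
    exact setIntegral_mono_ae (h.integrable_follower r).integrableOn
      (R.integrable_valueBound i r).integrableOn
      ((h.abs_follower_le r).mono fun ω hω => (le_abs_self _).trans hω)
  · rw [← R.setIntegral_valueBound i τ (hBτ.inter (τ.2.measurableSet_eq_stopping_time r.2))]
    exact setIntegral_mono_ae (h.integrable τ).integrableOn
      (R.integrable_valueBound i τ).integrableOn
      ((h.abs_le τ).mono fun ω hω => (le_abs_self _).trans hω)

end FirmPayoffs

end Deviations

section EssentialSuprema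

variable {Ω : Type*} {m : MeasurableSpace Ω} {P : Measure Ω}

lemma condExp_le_condExp_of_setIntegral_le [IsFiniteMeasure P] {m' : MeasurableSpace Ω}
    (hm : m' ≤ m) {f g : Ω → ℝ} (hf : Integrable f P) (hg : Integrable g P)
    (h : ∀ A, MeasurableSet[m'] A → ∫ ω in A, f ω ∂P ≤ ∫ ω in A, g ω ∂P) :
    P[f | m'] ≤ᵐ[P] P[g | m'] := by
  refine ae_of_ae_trim hm (ae_le_of_forall_setIntegral_le
    (integrable_condExp.trim hm stronglyMeasurable_condExp)
    (integrable_condExp.trim hm stronglyMeasurable_condExp) fun A hA _ => ?_)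
  rw [← setIntegral_trim hm stronglyMeasurable_condExp hA,
    ← setIntegral_trim hm stronglyMeasurable_condExp hA,
    setIntegral_condExp hm hf hA, setIntegral_condExp hm hg hA]
  exact h A hA

/-- A nonempty family of integrable random variables with an integrable upper bound has an
essential supremum. -/
theorem exists_isEssSup {S : Set (Ω → ℝ)} (hne : S.Nonempty) (hS : ∀ Y ∈ S, Integrable Y P)
    {Z : Ω → ℝ} (hZ : Integrable Z P) (hSZ : ∀ Y ∈ S, Y ≤ᵐ[P] Z) : ∃ V, IsEssSup P S V := by
  have hbdd : ∀ s : ℕ → S, ∀ᵐ ω ∂P, BddAbove (Set.range fun n => (s n).1 ω) := by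
    intro s
    filter_upwards [ae_all_iff.mpr fun n => hSZ _ (s n).2] with ω hω
    exact ⟨Z ω, by rintro _ ⟨n, rfl⟩; exact hω n⟩
  have hmeas : ∀ s : ℕ → S, AEMeasurable (fun ω => ⨆ n, (s n).1 ω) P :=
    fun s => AEMeasurable.iSup fun n => (hS _ (s n).2).aemeasurable
  have hleZ : ∀ s : ℕ → S, ∀ᵐ ω ∂P, ⨆ n, (s n).1 ω ≤ Z ω := by
    intro s
    filter_upwards [ae_all_iff.mpr fun n => hSZ _ (s n).2] with ω hω using ciSup_le hω
  have hint : ∀ s : ℕ → S, Integrable (fun ω => ⨆ n, (s n).1 ω) P := by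
    intro s
    refine integrable_of_le_of_le (hmeas s).aestronglyMeasurable ?_ (hleZ s) (hS _ (s 0).2) hZ
    filter_upwards [hbdd s] with ω hω using le_ciSup hω 0
  let I : (ℕ → S) → ℝ := fun s => ∫ ω, ⨆ n, (s n).1 ω ∂P
  have hIb : BddAbove (Set.range I) :=
    ⟨∫ ω, Z ω ∂P, by rintro _ ⟨s, rfl⟩; exact integral_mono_ae (hint s) hZ (hleZ s)⟩
  obtain ⟨Y₀, hY₀⟩ := hne
  have : Nonempty (ℕ → S) := ⟨fun _ => ⟨Y₀, hY₀⟩⟩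
  have hex : ∀ k : ℕ, ∃ s : ℕ → S, (⨆ s, I s) - 1 / ((k : ℝ) + 1) < I s := fun k =>
    exists_lt_of_lt_ciSup (sub_lt_self _ Nat.one_div_pos_of_nat)
  choose s hs using hex
  let t : ℕ → S := fun n => s n.unpair.1 n.unpair.2
  have hIt : ∀ k, I (s k) ≤ I t := by
    intro k
    refine integral_mono_ae (hint _) (hint _) ?_
    filter_upwards [hbdd t] with ω hω
    refine ciSup_le fun n => ?_
    have := le_ciSup hω (Nat.pair k n)
    simpa only [t, Nat.unpair_pair] using this
  have hmax : ∀ s', I s' ≤ I t := by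
    intro s'
    refine (le_ciSup hIb s').trans (le_of_tendsto' (x := atTop)
      (f := fun k : ℕ => (⨆ s, I s) - 1 / ((k : ℝ) + 1)) ?_ fun k => (hs k).le.trans (hIt k))
    have := (tendsto_const_nhds (x := ⨆ s, I s)).sub
      (tendsto_one_div_add_atTop_nhds_zero_nat (𝕜 := ℝ))
    rwa [sub_zero] at this
  refine ⟨fun ω => ⨆ n, (t n).1 ω, hmeas t, fun Y hY => ?_, fun W _ hW => ?_⟩
  · let t' : ℕ → S := fun n => Nat.casesOn n ⟨Y, hY⟩ t
    have hle : (fun ω => ⨆ n, (t n).1 ω) ≤ᵐ[P] fun ω => ⨆ n, (t' n).1 ω := by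
      filter_upwards [hbdd t'] with ω hω
      exact ciSup_le fun n => le_ciSup hω (n + 1)
    have heq := (integral_eq_iff_of_ae_le (hint t) (hint t') hle).mp
      (le_antisymm (integral_mono_ae (hint t) (hint t') hle) (hmax t'))
    filter_upwards [heq, hbdd t'] with ω h1 h2
    rw [h1]
    exact le_ciSup h2 0
  · filter_upwards [ae_all_iff.mpr fun n => hW _ (t n).2] with ω hω using ciSup_le hω

lemma IsEssSup.of_cofinal {S S' : Set (Ω → ℝ)} {V : Ω → ℝ} (h : IsEssSup P S V) (hsub : S' ⊆ S)
    (hcof : ∀ Y ∈ S, ∃ Y' ∈ S', Y ≤ᵐ[P] Y') : IsEssSup P S' V where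
  aemeasurable := h.aemeasurable
  le Y hY := h.le Y (hsub hY)
  least Z hZ hle := h.least Z hZ fun Y hY => by
    obtain ⟨Y', hY', hYY'⟩ := hcof Y hY
    exact hYY'.trans (hle Y' hY')

end EssentialSuprema

section MixedPlans

variable {Ω : Type*} {m : MeasurableSpace Ω} {P : Measure Ω} {𝓕 : Filtration ℝ≥0 m}
  [IsProbabilityMeasure P] {R : Revenues P 𝓕} {i : Firm} {τ σ ϑ : StopTime 𝓕}
  {L F M S : WithTop ℝ≥0 → Ω → ℝ} {A D : Set Ω}

namespace FirmPayoffs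

lemma integrable_prod (h : FirmPayoffs R i L F M S) (r : MixedPlan P ϑ) (τ : StopTime 𝓕) :
    Integrable (fun p : Ω × unitInterval => realized L F S τ (r.plan p.2) p.1)
      (P.prod volume) := by
  have hr : Measurable fun p : Ω × unitInterval => (r.plan p.2).1 p.1 :=
    r.measurable.comp measurable_swap
  have hFm : Measurable fun p : Ω × unitInterval => F ((r.plan p.2).1 p.1) p.1 :=
    h.follower.1.measurable_comp h.measurable_follower hr measurable_fst
  have hF : Integrable (fun p : Ω × unitInterval => F ((r.plan p.2).1 p.1) p.1)
      (P.prod volume) := by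
    refine (integrable_prod_iff' hFm.aestronglyMeasurable).mpr
      ⟨Eventually.of_forall fun u => h.integrable_follower (r.plan u), ?_⟩
    refine (integrable_const (∫ ω, R.totalBound i ω ∂P)).mono'
      hFm.norm.stronglyMeasurable.integral_prod_left'.aestronglyMeasurable
      (Eventually.of_forall fun u => ?_)
    rw [Real.norm_of_nonneg (integral_nonneg fun _ => norm_nonneg _)]
    exact h.integral_abs_follower_le (r.plan u)
  have hL : Integrable (fun p : Ω × unitInterval => L (τ.1 p.1) p.1) (P.prod volume) :=
    (h.integrable_leader τ).comp_fst volume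
  have hS : Integrable (fun p : Ω × unitInterval => S (τ.1 p.1) p.1) (P.prod volume) :=
    (h.integrable τ).comp_fst volume
  refine ((hL.abs.add hF.abs).add hS.abs).mono' ?_
    (Eventually.of_forall fun p => abs_outcome_le _ _ _)
  exact (aemeasurable_outcome (w := Prod.fst) (τ.measurable.comp measurable_fst) hr
    hL.aemeasurable hF.aemeasurable hS.aemeasurable).aestronglyMeasurable

lemma integrable_prod_restrict (h : FirmPayoffs R i L F M S) (r : MixedPlan P ϑ)
    (τ : StopTime 𝓕) (D : Set Ω) :
    Integrable (fun p : Ω × unitInterval => realized L F S τ (r.plan p.2) p.1)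
      ((P.restrict D).prod volume) := by
  have := (h.integrable_prod r τ).integrableOn (s := D ×ˢ Set.univ)
  rwa [IntegrableOn, ← Measure.prod_restrict, Measure.restrict_univ] at this

lemma integrable_average (h : FirmPayoffs R i L F M S) (r : MixedPlan P ϑ) (τ : StopTime 𝓕) :
    Integrable (fun ω => ∫ u : unitInterval, realized L F S τ (r.plan u) ω) P :=
  (h.integrable_prod r τ).integral_prod_left

lemma integrable_setIntegral (h : FirmPayoffs R i L F M S) (r : MixedPlan P ϑ) (τ : StopTime 𝓕)
    (D : Set Ω) :
    Integrable (fun u : unitInterval => ∫ ω in D, realized L F S τ (r.plan u) ω ∂P) :=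
  (h.integrable_prod_restrict r τ D).integral_prod_right

lemma setIntegral_average (h : FirmPayoffs R i L F M S) (r : MixedPlan P ϑ) (τ : StopTime 𝓕)
    (D : Set Ω) :
    ∫ ω in D, (∫ u : unitInterval, realized L F S τ (r.plan u) ω) ∂P =
      ∫ u : unitInterval, ∫ ω in D, realized L F S τ (r.plan u) ω ∂P :=
  integral_integral_swap (h.integrable_prod_restrict r τ D)

lemma setIntegral_expectedPayoff (h : FirmPayoffs R i L F M S) (r : MixedPlan P ϑ)
    (τ : StopTime 𝓕) (hD : MeasurableSet[ϑ.info] D) :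
    ∫ ω in D, expectedPayoff L F S r τ ω ∂P =
      ∫ u : unitInterval, ∫ ω in D, realized L F S τ (r.plan u) ω ∂P := by
  rw [← h.setIntegral_average r τ D]
  exact setIntegral_condExp ϑ.info_le (h.integrable_average r τ) hD

lemma expectedPayoff_le_bound (h : FirmPayoffs R i L F M S) (r : MixedPlan P ϑ)
    (hτ : ϑ.1 ≤ᵐ[P] τ.1) :
    expectedPayoff L F S r τ ≤ᵐ[P] P[R.totalBound i | ϑ.info] := by
  refine condExp_le_condExp_of_setIntegral_le ϑ.info_le (h.integrable_average r τ)
    (R.integrable_totalBound i) fun D hD => ?_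
  have h1 : ∫ u : unitInterval, ∫ ω in D, realized L F S τ (r.plan u) ω ∂P ≤
      ∫ _ : unitInterval, (∫ ω in D, R.totalBound i ω ∂P) :=
    integral_mono (h.integrable_setIntegral r τ D) (integrable_const _)
      fun u => h.setIntegral_realized_le hτ (r.ge u) hD
  rw [integral_const, probReal_univ, one_smul] at h1
  exact (h.setIntegral_average r τ D).trans_le h1

lemma expectedPayoff_mono (h : FirmPayoffs R i L F M S) (r : MixedPlan P ϑ)
    (hle : ∀ u, ∀ D, MeasurableSet[ϑ.info] D → ∫ ω in D, realized L F S τ (r.plan u) ω ∂P ≤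
      ∫ ω in D, realized L F S σ (r.plan u) ω ∂P) :
    expectedPayoff L F S r τ ≤ᵐ[P] expectedPayoff L F S r σ := by
  refine condExp_le_condExp_of_setIntegral_le ϑ.info_le (h.integrable_average r τ)
    (h.integrable_average r σ) fun D hD => ?_
  have h1 := integral_mono (h.integrable_setIntegral r τ D) (h.integrable_setIntegral r σ D)
    fun u => hle u D hD
  exact (h.setIntegral_average r τ D).trans_le (h1.trans_eq (h.setIntegral_average r σ D).symm)

lemma exists_isEssSup_expectedPayoff (h : FirmPayoffs R i L F M S) (r : MixedPlan P ϑ) :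
    ∃ V, IsEssSup P {Y | ∃ τ : StopTime 𝓕, ϑ.1 ≤ᵐ[P] τ.1 ∧ Y = expectedPayoff L F S r τ} V := by
  refine exists_isEssSup ⟨_, ϑ, EventuallyLE.refl _ _, rfl⟩ ?_ (Z := P[R.totalBound i | ϑ.info])
    integrable_condExp ?_
  · rintro _ ⟨τ, -, rfl⟩
    exact integrable_condExp
  · rintro _ ⟨τ, hτ, rfl⟩
    exact h.expectedPayoff_le_bound r hτ

/-- An optimal plan does not invest, as leader or simultaneously, where following is worth more
than leading. -/
theorem ae_lt_of_isOptimalOn (h : FirmPayoffs R i L F M S) (r : MixedPlan P ϑ) {B : Set Ω}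
    (hB : MeasurableSet[ϑ.info] B) (hopt : IsOptimalOn L F S r τ B) :
    ∀ᵐ ω ∂P, ω ∈ B → L (τ.1 ω) ω < F (τ.1 ω) ω →
      ∀ᵐ u : unitInterval, (r.plan u).1 ω < τ.1 ω := by
  obtain ⟨σ, hσ⟩ := h.exists_optimal τ
  obtain ⟨Y, hY⟩ := h.leader τ
  have hF := h.follower.isValue hσ
  set A : Set Ω := (B ∩ {ω | ϑ.1 ω ≤ τ.1 ω}) ∩ ({ω | τ.1 ω ≤ σ.1 ω} ∩
    {ω | (P[Y | τ.info]) ω < (P[followerStream R i τ σ | τ.info]) ω}) with hAdef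
  have hBτ : MeasurableSet[τ.info] (B ∩ {ω | ϑ.1 ω ≤ τ.1 ω}) :=
    StopTime.measurableSet_of_le (hB.inter (ϑ.measurableSet_le_left τ)) fun ω hω => hω.2
  have hA : MeasurableSet[τ.info] A :=
    hBτ.inter ((τ.measurableSet_le_left σ).inter
      (measurableSet_lt stronglyMeasurable_condExp.measurable
        stronglyMeasurable_condExp.measurable))
  have hAm : MeasurableSet A := τ.info_le _ hA
  have hAσ : ∀ ω ∈ A, τ.1 ω ≤ σ.1 ω := fun ω hω => hω.2.1
  have hA' := StopTime.measurableSet_of_le hA hAσ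
  have hAB : B ∩ A = A := Set.inter_eq_right.mpr fun ω hω => hω.1.1
  have hAlt : ∀ᵐ ω ∂P, ω ∈ A → L (τ.1 ω) ω < F (τ.1 ω) ω := by
    filter_upwards [hY.eq, hF.eq] with ω h1 h2 hω
    rw [h1, h2]
    exact add_lt_add_right hω.2.2 _
  set ρ := τ.paste σ A hA hA'
  set h₀ : Ω × unitInterval → ℝ := {p | p.1 ∈ A ∧ τ.1 p.1 ≤ (r.plan p.2).1 p.1}.indicator
    fun p => F (τ.1 p.1) p.1 - L (τ.1 p.1) p.1 with hh₀
  have hr : Measurable fun p : Ω × unitInterval => (r.plan p.2).1 p.1 :=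
    r.measurable.comp measurable_swap
  have hi : Integrable h₀ (P.prod volume) :=
    (((h.integrable_follower τ).sub (h.integrable_leader τ)).comp_fst volume).indicator
      ((measurable_fst hAm).inter (measurableSet_le (τ.measurable.comp measurable_fst) hr))
  have hnn : 0 ≤ᵐ[P.prod volume] h₀ := by
    have h1 := Measure.quasiMeasurePreserving_fst (μ := P) (ν := (volume : Measure unitInterval))
    filter_upwards [h1.ae hAlt] with p hp
    refine Set.indicator_apply_nonneg fun hpA => ?_
    have := hp hpA.1
    linarith
  have hgain : ∀ u : unitInterval, ∫ ω, h₀ (ω, u) ∂P ≤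
      ∫ ω in B, realized L F S ρ (r.plan u) ω ∂P - ∫ ω in B, realized L F S τ (r.plan u) ω ∂P := by
    intro u
    have h1 : ∫ ω, h₀ (ω, u) ∂P =
        ∫ ω in (B ∩ A) ∩ {ω | τ.1 ω ≤ (r.plan u).1 ω}, (F (τ.1 ω) ω - L (τ.1 ω) ω) ∂P := by
      rw [hAB, ← integral_indicator
        (hAm.inter (measurableSet_le τ.measurable (r.plan u).measurable))]
      rfl
    rw [h1]
    refine h.gain_paste_le hA hA' hAσ (ϑ.info_le _ hB) (hAB.symm ▸ hA) (fun E _ hE => ?_)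
      (h.integrable_leader τ) ?_
    · exact (hF.setIntegral_eq hE).le
    · filter_upwards [hAlt, h.le_leader τ] with ω h1 h2 hω hle
      rcases hle.lt_or_eq with hlt | heq
      · rw [realized, outcome_of_lt hlt]
      · rw [realized, outcome_of_eq heq]
        exact h2 (h1 hω)
  have hle0 : ∫ p, h₀ p ∂(P.prod volume) ≤ 0 := by
    rw [integral_prod_symm _ hi]
    refine (integral_mono hi.integral_prod_right ((h.integrable_setIntegral r ρ B).sub
      (h.integrable_setIntegral r τ B)) hgain).trans ?_
    change ∫ u : unitInterval, (∫ ω in B, realized L F S ρ (r.plan u) ω ∂P -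
      ∫ ω in B, realized L F S τ (r.plan u) ω ∂P) ≤ 0
    rw [integral_sub (h.integrable_setIntegral r ρ B) (h.integrable_setIntegral r τ B),
      ← h.setIntegral_expectedPayoff r ρ hB, ← h.setIntegral_expectedPayoff r τ hB, sub_nonpos]
    refine setIntegral_mono_on_ae integrable_condExp.integrableOn integrable_condExp.integrableOn
      (ϑ.info_le _ hB) (hopt.2 ρ ?_)
    filter_upwards [hopt.1] with ω hω using hω.trans (StopTime.le_paste hA hA' hAσ ω)
  have h0 : h₀ =ᵐ[P.prod volume] 0 :=
    (integral_eq_zero_iff_of_nonneg_ae hnn hi).mp (le_antisymm hle0 (integral_nonneg_of_ae hnn))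
  filter_upwards [Measure.ae_ae_of_ae_prod h0, hopt.1, hσ.1, hY.eq, hF.eq]
    with ω h1 h2 h3 h4 h5 hωB hlt
  have hωA : ω ∈ A := by
    refine ⟨⟨hωB, h2⟩, h3, ?_⟩
    rw [h4, h5] at hlt
    exact lt_of_add_lt_add_left hlt
  filter_upwards [h1] with u hu
  by_contra! hle
  have hmem : (ω, u) ∈ {p : Ω × unitInterval | p.1 ∈ A ∧ τ.1 p.1 ≤ (r.plan p.2).1 p.1} :=
    ⟨hωA, hle⟩
  rw [hh₀, Set.indicator_of_mem hmem] at hu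
  change F (τ.1 ω) ω - L (τ.1 ω) ω = 0 at hu
  linarith

/-- The optimal time to follow an investment at `ϑ` remains optimal as long as it has not
been reached. -/
lemma setIntegral_follower_le (h : FirmPayoffs R i L F M S) (hσ : IsOptimalFollowerTime R i ϑ σ)
    (hA : MeasurableSet[τ.info] A) (hϑτ : ∀ ω ∈ A, ϑ.1 ω ≤ τ.1 ω) (hτσ : ∀ ω ∈ A, τ.1 ω ≤ σ.1 ω) :
    ∫ ω in A, F (τ.1 ω) ω ∂P ≤
      ∫ ω in A, (pastRevenue R i τ ω + followerStream R i τ σ ω) ∂P := by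
  obtain ⟨s, hs⟩ := h.exists_optimal τ
  set s' := τ.later s with hs'
  have hτs' : ∀ ω, τ.1 ω ≤ s'.1 ω := fun ω => le_max_left _ _
  have hAσ := StopTime.measurableSet_of_le hA hτσ
  have hAs' := StopTime.measurableSet_of_le hA (σ := s') fun ω _ => hτs' ω
  have hAm : MeasurableSet A := τ.info_le _ hA
  set ρ := σ.paste s' A hAσ hAs' with hρ
  have hϑρ : ϑ.1 ≤ᵐ[P] ρ.1 := by
    filter_upwards [hσ.1] with ω hω
    by_cases hωA : ω ∈ A
    · rw [hρ, StopTime.paste_of_mem hAσ hAs' hωA]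
      exact (hϑτ ω hωA).trans (hτs' ω)
    · rwa [hρ, StopTime.paste_of_notMem hAσ hAs' hωA]
  have hiρ := integrable_followerStream R i ϑ ρ
  have hiσ := integrable_followerStream R i ϑ σ
  have h1 : ∫ ω, followerStream R i ϑ ρ ω ∂P ≤ ∫ ω, followerStream R i ϑ σ ω ∂P := by
    rw [← integral_condExp ϑ.info_le (f := followerStream R i ϑ ρ),
      ← integral_condExp ϑ.info_le (f := followerStream R i ϑ σ)]
    exact integral_mono_ae integrable_condExp integrable_condExp (hσ.2 ρ hϑρ)
  have h2 : ∫ ω in A, (followerStream R i ϑ ρ ω - followerStream R i ϑ σ ω) ∂P ≤ 0 := by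
    rw [setIntegral_eq_integral_of_forall_compl_eq_zero, integral_sub hiρ hiσ]
    · linarith
    · intro ω hω
      rw [followerStream, followerStream, hρ, StopTime.paste_of_notMem hAσ hAs' hω, sub_self]
  have his := integrable_followerStream R i τ s
  have hiτ := integrable_followerStream R i τ σ
  have h3 : ∫ ω in A, (followerStream R i ϑ ρ ω - followerStream R i ϑ σ ω) ∂P =
      ∫ ω in A, (followerStream R i τ s ω - followerStream R i τ σ ω) ∂P := by
    refine setIntegral_congr_ae hAm ?_
    filter_upwards [R.ae_regular, hs.1] with ω hω hle hωA
    have e : s'.1 ω = s.1 ω := max_eq_right hle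
    rw [followerStream, followerStream, followerStream, followerStream, hρ,
      StopTime.paste_of_mem hAσ hAs' hωA, e, ← accrued_add (hω.intF i) (hϑτ ω hωA) hle,
      ← accrued_add (hω.intF i) (hϑτ ω hωA) (hτσ ω hωA)]
    ring
  have hp := integrable_pastRevenue R i τ
  rw [h3, integral_sub his.integrableOn hiτ.integrableOn] at h2
  rw [(h.follower.isValue hs).setIntegral_eq hA, integral_add hp.integrableOn his.integrableOn,
    integral_add hp.integrableOn hiτ.integrableOn]
  linarith

end FirmPayoffs

end MixedPlans

section Game

variable {Ω : Type*} {m : MeasurableSpace Ω} {P : Measure Ω} [IsProbabilityMeasure P]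
  {𝓕 : Filtration ℝ≥0 m} {R : Revenues P 𝓕} {τF : Firm → StopTime 𝓕 → StopTime 𝓕}
  {L F M S : Firm → WithTop ℝ≥0 → Ω → ℝ}

/-- The preemption time from a stopping time on, as a stopping time. -/
noncomputable def preemptionStopTime (h𝓕 : UsualConditions P 𝓕)
    (hτF : ∀ i τ, IsFollowerTime R i τ (τF i τ)) (hL : ∀ i, IsLeaderPayoff R τF i (L i))
    (hF : ∀ i, IsFollowerPayoff R i (F i)) (τ : StopTime 𝓕) : StopTime 𝓕 :=
  ⟨fun ω => preemptionTime L F (τ.1 ω) ω,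
    isStoppingTime_preemptionTime h𝓕 (fun i => (hL i).1) (fun i => (hF i).1)
      (fun i t => ((hL i).isValue (StopTime.const 𝓕 t)).measurable h𝓕)
      (fun i t => ((hF i).isValue (hτF i (StopTime.const 𝓕 t)).1).measurable h𝓕) τ⟩

lemma preemptionPayoff_mem (i : Firm) (t : WithTop ℝ≥0) (ω : Ω) :
    preemptionPayoff L F M i t ω = L i t ω ∨ preemptionPayoff L F M i t ω = F i t ω ∨
      preemptionPayoff L F M i t ω = M i t ω := by
  rw [preemptionPayoff]
  split_ifs
  exacts [Or.inl rfl, Or.inr (Or.inl rfl), Or.inr (Or.inr rfl)]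

lemma firmPayoffs (h𝓕 : UsualConditions P 𝓕) (hτF : ∀ i τ, IsFollowerTime R i τ (τF i τ))
    (hL : ∀ i, IsLeaderPayoff R τF i (L i)) (hF : ∀ i, IsFollowerPayoff R i (F i))
    (hM : ∀ i, IsSimultaneousPayoff R i (M i)) (hS : S = M ∨ S = preemptionPayoff L F M)
    (i : Firm) : FirmPayoffs R i (L i) (F i) (M i) (S i) := by
  have hLv : ∀ i (τ : StopTime 𝓕), Measurable fun ω => L i (τ.1 ω) ω := fun i τ =>
    h𝓕.measurable_of_aemeasurable ((hL i).isValue τ).integrable_value.aemeasurable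
  have hFv : ∀ i (τ : StopTime 𝓕), Measurable fun ω => F i (τ.1 ω) ω := fun i τ =>
    h𝓕.measurable_of_aemeasurable ((hF i).isValue (hτF i τ).1).integrable_value.aemeasurable
  have hMv : ∀ i (τ : StopTime 𝓕), Measurable fun ω => M i (τ.1 ω) ω := fun i τ =>
    h𝓕.measurable_of_aemeasurable ((hM i).isValue τ).integrable_value.aemeasurable
  have hmem : ∀ t ω, S i t ω = L i t ω ∨ S i t ω = F i t ω ∨ S i t ω = M i t ω := by
    intro t ω
    rcases hS with rfl | rfl
    · exact Or.inr (Or.inr rfl)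
    · exact preemptionPayoff_mem i t ω
  have hML : ∀ τ : StopTime 𝓕, ∀ᵐ ω ∂P, M i (τ.1 ω) ω ≤ L i (τ.1 ω) ω := fun τ =>
    simultaneous_le_leader (hτF _ τ).1.1 (hM i) (hL i)
  have hMF : ∀ τ : StopTime 𝓕, ∀ᵐ ω ∂P, M i (τ.1 ω) ω ≤ F i (τ.1 ω) ω :=
    simultaneous_le_follower (hM i) (hF i)
  refine ⟨hF i, fun τ => ⟨_, (hτF i τ).1⟩, fun τ => ⟨_, (hL i).isValue τ⟩, hM i, hML,
    fun τ => ?_, fun τ => ?_, fun τ => ?_, fun τ => ?_, hmem, fun t => ?_⟩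
  · filter_upwards [hML τ, hMF τ] with ω h1 h2
    rcases hmem (τ.1 ω) ω with e | e | e <;> rw [e]
    exacts [h1, h2]
  · filter_upwards [hMF τ] with ω h2 hLF
    rcases hmem (τ.1 ω) ω with e | e | e <;> rw [e]
    exacts [hLF, h2]
  · filter_upwards [hML τ] with ω h1 hlt
    rcases hS with rfl | rfl
    · exact h1
    · rw [preemptionPayoff, if_neg]
      · exact h1
      · rintro ⟨ht, he⟩
        exact hlt.not_ge (le_of_preemptionTime_eq (fun i => (hL i).1) (fun i => (hF i).1) ht he i)
  · rcases hS with rfl | rfl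
    · exact (hMv i τ).aemeasurable
    · refine Measurable.aemeasurable ?_
      have hs : MeasurableSet {ω | τ.1 ω ≠ ⊤ ∧ preemptionTime L F (τ.1 ω) ω = τ.1 ω} :=
        (τ.measurable (measurableSet_singleton ⊤)).compl.inter
          (measurableSet_eq_fun (preemptionStopTime h𝓕 hτF hL hF τ).measurable τ.measurable)
      exact Measurable.ite hs (Measurable.ite (measurableSet_eq_fun (hLv _ τ) (hFv _ τ))
        (hLv i τ) (hFv i τ)) (hMv i τ)
  · cases t with
    | top =>
      have ht : IsStoppingTime 𝓕 fun _ : Ω => (⊤ : WithTop ℝ≥0) := fun s => by simp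
      exact hFv i ⟨_, ht⟩
    | coe t => exact hFv i (StopTime.const 𝓕 t)

/-- Firm `2` does not gain from investing before both the preemption time and its follower time. -/
lemma exists_later_plan (h𝓕 : UsualConditions P 𝓕) (hτF : ∀ i τ, IsFollowerTime R i τ (τF i τ))
    (hL : ∀ i, IsLeaderPayoff R τF i (L i)) (hF : ∀ i, IsFollowerPayoff R i (F i))
    (hM : ∀ i, IsSimultaneousPayoff R i (M i)) (hS : S = M ∨ S = preemptionPayoff L F M)
    {ϑ τ : StopTime 𝓕} (r : MixedPlan P ϑ) (hτ : ϑ.1 ≤ᵐ[P] τ.1) :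
    ∃ ρ : StopTime 𝓕,
      (∀ᵐ ω ∂P, min (preemptionTime L F (ϑ.1 ω) ω) ((τF .two ϑ).1 ω) ≤ ρ.1 ω) ∧
      expectedPayoff (L .two) (F .two) (S .two) r τ ≤ᵐ[P]
        expectedPayoff (L .two) (F .two) (S .two) r ρ := by
  have h := firmPayoffs h𝓕 hτF hL hF hM hS .two
  set p := preemptionStopTime h𝓕 hτF hL hF ϑ with hp
  set σ := τF .two ϑ with hσ
  set A : Set Ω := {ω | ϑ.1 ω ≤ τ.1 ω} ∩ ({ω | τ.1 ω < p.1 ω} ∩ {ω | τ.1 ω < σ.1 ω}) with hAdef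
  have hA0 : MeasurableSet[τ.info] ({ω | τ.1 ω < p.1 ω} ∩ {ω | τ.1 ω < σ.1 ω}) :=
    (τ.measurableSet_lt_left p).inter (τ.measurableSet_lt_left σ)
  have hA : MeasurableSet[τ.info] A := (ϑ.measurableSet_le_right τ).inter hA0
  have hAσ : ∀ ω ∈ A, τ.1 ω ≤ σ.1 ω := fun ω hω => le_of_lt hω.2.2
  have hA' := StopTime.measurableSet_of_le hA hAσ
  have hLF : ∀ᵐ ω ∂P, ω ∈ A → L .two (τ.1 ω) ω ≤ F .two (τ.1 ω) ω := by
    filter_upwards [leader_advantage_le hτF hL hF τ] with ω hω hωA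
    by_contra! hlt
    have hle : p.1 ω ≤ τ.1 ω :=
      preemptionTime_le hωA.1 (ne_top_of_lt hωA.2.1) (by linarith) hlt
    exact hle.not_gt hωA.2.1
  refine ⟨τ.paste σ A hA hA', ?_, h.expectedPayoff_mono r fun u D hD => ?_⟩
  · filter_upwards [hτ] with ω hω
    by_cases hωA : ω ∈ A
    · rw [StopTime.paste_of_mem hA hA' hωA]
      exact min_le_right _ _
    · rw [StopTime.paste_of_notMem hA hA' hωA, min_le_iff]
      by_contra! hlt
      exact hωA ⟨hω, hlt.1, hlt.2⟩
  · have hDA : MeasurableSet[τ.info] (D ∩ A) := by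
      rw [hAdef, ← Set.inter_assoc]
      exact (StopTime.measurableSet_of_le (hD.inter (ϑ.measurableSet_le_left τ))
        fun ω hω => hω.2).inter hA0
    have hgain := h.gain_paste_le (r := r.plan u) hA hA' hAσ (ϑ.info_le _ hD) hDA
      (fun E hEA hE => h.setIntegral_follower_le (hτF .two ϑ).1 hE
        (fun ω hω => (hEA hω).1) (fun ω hω => hAσ ω (hEA hω)))
      (h.integrable_follower τ) ?_
    · simp only [sub_self, integral_zero] at hgain
      linarith
    · filter_upwards [hLF, h.le_follower τ] with ω h1 h2 hωA hle
      rcases hle.lt_or_eq with hlt | heq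
      · rw [realized, outcome_of_lt hlt]
        exact h1 hωA
      · rw [realized, outcome_of_eq heq]
        exact h2 (h1 hωA)

end Game

end TimingGame

open TimingGame in
theorem lemma4 {Ω : Type*} {m : MeasurableSpace Ω} (P : Measure Ω) [IsProbabilityMeasure P]
    (𝓕 : Filtration ℝ≥0 m) (h𝓕 : UsualConditions P 𝓕) (R : Revenues P 𝓕)
    (τF : Firm → StopTime 𝓕 → StopTime 𝓕) (hτF : ∀ i τ, IsFollowerTime R i τ (τF i τ))
    (L F M : Firm → WithTop ℝ≥0 → Ω → ℝ)
    (hL : ∀ i, IsLeaderPayoff R τF i (L i)) (hF : ∀ i, IsFollowerPayoff R i (F i))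
    (hM : ∀ i, IsSimultaneousPayoff R i (M i))
    -- payoffs when both firms plan to invest at the same date, without or with preemption
    (S : Firm → WithTop ℝ≥0 → Ω → ℝ) (hS : S = M ∨ S = preemptionPayoff L F M) :
    -- a plan that is optimal on an event never invests there where `F i > L i`:
    -- the opponent has then surely invested before
    (∀ (i : Firm) (ϑ : StopTime 𝓕) (r : MixedPlan P ϑ) (τ : StopTime 𝓕) (B : Set Ω),
      MeasurableSet[ϑ.info] B → IsOptimalOn (L i) (F i) (S i) r τ B →
      ∀ᵐ ω ∂P, ω ∈ B → L i (τ.1 ω) ω < F i (τ.1 ω) ω →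
        ∀ᵐ u : unitInterval, (r.plan u).1 ω < τ.1 ω) ∧
    -- of the preemption time and its follower time
    (∀ (ϑ : StopTime 𝓕) (r : MixedPlan P ϑ), ∃ V : Ω → ℝ,
      IsEssSup P {Y | ∃ τ : StopTime 𝓕, ϑ.1 ≤ᵐ[P] τ.1 ∧
        Y = expectedPayoff (L .two) (F .two) (S .two) r τ} V ∧
      IsEssSup P {Y | ∃ τ : StopTime 𝓕,
        (∀ᵐ ω ∂P, min (preemptionTime L F (ϑ.1 ω) ω) ((τF .two ϑ).1 ω) ≤ τ.1 ω) ∧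
        Y = expectedPayoff (L .two) (F .two) (S .two) r τ} V) := by
  refine ⟨fun i ϑ r τ B hB hopt =>
    (firmPayoffs h𝓕 hτF hL hF hM hS i).ae_lt_of_isOptimalOn r hB hopt, fun ϑ r => ?_⟩
  obtain ⟨V, hV⟩ := (firmPayoffs h𝓕 hτF hL hF hM hS .two).exists_isEssSup_expectedPayoff r
  refine ⟨V, hV, hV.of_cofinal ?_ ?_⟩
  · rintro _ ⟨τ, hτ, rfl⟩
    refine ⟨τ, ?_, rfl⟩
    filter_upwards [hτ, (hτF .two ϑ).1.1] with ω h1 h2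
    exact (le_min (le_preemptionTime _ _) h2).trans h1
  · rintro _ ⟨τ, hτ, rfl⟩
    obtain ⟨ρ, hρ, hle⟩ := exists_later_plan h𝓕 hτF hL hF hM hS r hτ
    exact ⟨_, ⟨ρ, hρ, rfl⟩, hle⟩
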